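/- Theorem (asymptotic optimality of detect-then-separate in the Gaussian mixture signal model). Let $y[n]=s[n]+b[n]$, $n=1,2,\dots$, be complex-valued random sequences, and let $\mathsf k$ be a random type in $\{1,\dots,K\}$ with an arbitrary prior distribution. Assume that, conditioned on $\mathsf k=k$ (for each $k$ of positive probability), $s$ and $b$ are independent zero-mean circularly symmetric complex Gaussian processes. For every $N$, write $\mathbf s,\mathbf b,\mathbf y$ for the vectors of the first $N$ samples, and assume that given $\mathsf k=k$ we have $\mathbf s\sim\mathcal{CN}(\mathbf 0,\mathbf C_s)$ and $\mathbf b\sim\mathcal{CN}(\mathbf 0,\mathbf C_{b_k})$, where $\mathbf C_s$ does not depend on $k$. Assume that each $s[n]$ has unit variance and that there are constants $\sigma^2>0$ and $M<\infty$, independent of $N$, such that for all $k$ and $N$ the matrix $\mathbf C_{b_k}-\sigma^2\mathbf I$ is positive semidefinite and the diagonal entries of $\mathbf C_{b_k}$ are at most $M$. (This holds in particular if the interference is $b=\rho_{\rm SIR}^{-1/2}v_{\mathsf k}+\rho_{\rm SNR}^{-1/2}w$ with $v_k$ of unit variance, $w$ white of unit variance, independent of $v_k$, and fixed $\rho_{\rm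 SIR},\rho_{\rm SNR}>0$.) Put $\mathbf C_{y_k}=\mathbf C_s+\mathbf C_{b_k}$ and $\psi_N(\mathbf y,k)=\frac1N\mathbf y^{\mathsf H}\mathbf C_{y_k}^{-1}\mathbf y-1$. Assume the temporal-diversity condition: for all types $k\neq\ell$ there is a constant $c>0$ such that, given $\mathsf k=k$, almost surely $|\psi_N(\mathbf y,\ell)|\ge c$ for all sufficiently large $N$. (This holds in particular if, given $\mathsf k=k$, $|\psi_N(\mathbf y,\ell)|$ converges almost surely to a nonzero constant.) For each $N$ let $\widehat{\mathbf s}_{\rm MMSE}=\mathbb E[\mathbf s\mid\mathbf y]$, let $\widehat{\mathsf k}_{\rm MAP}$ be a maximum a posteriori detector of $\mathsf k$ from $\mathbf y$ (with an arbitrary measurable rule for ties), and let $$\widehat{\mathbf s}_{\rm DTS}=\mathbf C_s\,\mathbf C_{y_{k}}^{-1}\,\mathbf y\ \text{ with } k=\widehat{\mathsf k}_{\rm MAP}.$$ Then $$\lim_{N\to\infty}\frac{\mathbb E\big[\|\widehat{\mathbf s}_{\rm MMSE}-\mathbf s\|_2^2\big]}{\mathbb E\big[\|\widehat{\mathbf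 s}_{\rm DTS}-\mathbf s\|_2^2\big]}=1.$$ -/

import Mathlib

open MeasureTheory ProbabilityTheory Filter Topology
open scoped Matrix ComplexConjugate ComplexOrder

noncomputable section

namespace DTS

/-- `X` is a zero-mean circularly symmetric complex Gaussian process with covariance function
`C m n = E[X m * conj (X n)]`. Equivalently, for each `N` the first `N` samples form a vector with
law `CN(0, C_N)`, where `C_N` is the leading `N × N` block of `C`. -/
structure IsCircularGaussianProcess {Ω : Type*} [MeasurableSpace Ω]
    (X : ℕ → Ω → ℂ) (C : Matrix ℕ ℕ ℂ) (μ : Measure Ω) : Prop where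
  gaussian : IsGaussianProcess X μ
  mean_zero : ∀ n, ∫ ω, X n ω ∂μ = 0
  covariance : ∀ m n, ∫ ω, X m ω * conj (X n ω) ∂μ = C m n
  circular : ∀ m n, ∫ ω, X m ω * X n ω ∂μ = 0

/-- The leading `N × N` block of a covariance function. -/
def block (C : Matrix ℕ ℕ ℂ) (N : ℕ) : Matrix (Fin N) (Fin N) ℂ :=
  C.submatrix Fin.val Fin.val

/-- The batch of the first `N` samples of a process. -/
def batch {Ω : Type*} (X : ℕ → Ω → ℂ) (N : ℕ) (ω : Ω) : EuclideanSpace ℂ (Fin N) :=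
  WithLp.toLp 2 fun i => X i ω

/-- The received mixture `y[n] = s[n] + b[n]`. -/
def mixture {Ω : Type*} (s b : ℕ → Ω → ℂ) : ℕ → Ω → ℂ := fun n ω => s n ω + b n ω

/-- The Gaussian mixture signal model. The random variable `k` is the interference type, `s` the
signal of interest, and `b` the realized effective interference (structured interference plus
white noise). Its prior is the law of `k`, which is arbitrary. -/
structure GaussianMixtureModel {Ω : Type*} [MeasurableSpace Ω] (μ : Measure Ω) {K : ℕ}
    (k : Ω → Fin K) (s b : ℕ → Ω → ℂ) (Cs : Matrix ℕ ℕ ℂ) (Cb : Fin K → Matrix ℕ ℕ ℂ) :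
    Prop where
  measurable_type : Measurable k
  measurable_soi : ∀ n, Measurable (s n)
  measurable_interference : ∀ n, Measurable (b n)
  /-- Whatever the type, the signal of interest is `CN(0, C_s)`. -/
  soi_gaussian : ∀ j, μ (k ⁻¹' {j}) ≠ 0 → IsCircularGaussianProcess s Cs μ[|k ⁻¹' {j}]
  /-- Conditioned on type `j`, the interference is `CN(0, C_{b_j})`. -/
  interference_gaussian : ∀ j, μ (k ⁻¹' {j}) ≠ 0 →
    IsCircularGaussianProcess b (Cb j) μ[|k ⁻¹' {j}]
  /-- Conditioned on the type, signal and interference are independent. -/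
  indep : ∀ j, μ (k ⁻¹' {j}) ≠ 0 →
    IndepFun (fun ω n => s n ω) (fun ω n => b n ω) μ[|k ⁻¹' {j}]
  /-- The signal of interest has unit variance. -/
  soi_unit_variance : ∀ n, Cs n n = 1
  /-- The interference contains white noise of some fixed positive variance. -/
  noise_floor : ∃ σ2 : ℝ, 0 < σ2 ∧ ∀ j N, (block (Cb j) N - (σ2 : ℂ) • 1).PosSemidef
  /-- The variance of the interference samples is bounded. -/
  interference_variance : ∃ M : ℝ, ∀ j n, (Cb j n n).re ≤ M

/-- The covariance matrix `C_{y_j} = C_s + C_{b_j}` of the first `N` samples of the mixture, given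
type `j`. -/
def mixtureCov (Cs Cj : Matrix ℕ ℕ ℂ) (N : ℕ) : Matrix (Fin N) (Fin N) ℂ :=
  block Cs N + block Cj N

/-- The linear MMSE estimator `C_s (C_s + C_{b_j})⁻¹ y` for a known type `j`. -/
def lmmse (Cs Cj : Matrix ℕ ℕ ℂ) (N : ℕ) (y : EuclideanSpace ℂ (Fin N)) :
    EuclideanSpace ℂ (Fin N) :=
  WithLp.toLp 2 ((block Cs N * (mixtureCov Cs Cj N)⁻¹) *ᵥ y.ofLp)

/-- The statistic `ψ_N(y, j) = (1/N) yᴴ C_{y_j}⁻¹ y - 1` (the quadratic form is real). -/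
def psi (Cs Cj : Matrix ℕ ℕ ℂ) (N : ℕ) (y : EuclideanSpace ℂ (Fin N)) : ℝ :=
  (1 / (N : ℝ)) * (star y.ofLp ⬝ᵥ ((mixtureCov Cs Cj N)⁻¹ *ᵥ y.ofLp)).re - 1

/-- The temporal-diversity condition: given type `j`, the statistic of every other type `l` is,
almost surely, eventually bounded away from zero by a deterministic constant. This holds in
particular if it converges almost surely to a nonzero constant. -/
def TemporalDiversity {Ω : Type*} [MeasurableSpace Ω] (μ : Measure Ω) {K : ℕ}
    (k : Ω → Fin K) (s b : ℕ → Ω → ℂ) (Cs : Matrix ℕ ℕ ℂ) (Cb : Fin K → Matrix ℕ ℕ ℂ) : Prop :=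
  ∀ j l, l ≠ j → ∃ c : ℝ, 0 < c ∧
    ∀ᵐ ω ∂μ[|k ⁻¹' {j}], ∀ᶠ N in atTop, c ≤ |psi Cs (Cb l) N (batch (mixture s b) N ω)|

/-- The sigma-algebra generated by the first `N` samples of a process. -/
@[reducible] def sampleSigma {Ω : Type*} (X : ℕ → Ω → ℂ) (N : ℕ) : MeasurableSpace Ω :=
  MeasurableSpace.comap (batch X N) inferInstance

/-- A detector `d`, that is, a measurable function of the first `N` samples of `y`, is MAP if it
always selects a type of maximal posterior probability given these samples (ties are broken
arbitrarily). -/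
def IsMAPDetector {Ω : Type*} [MeasurableSpace Ω] (μ : Measure Ω) {K : ℕ} (k : Ω → Fin K)
    (y : ℕ → Ω → ℂ) (N : ℕ) (d : EuclideanSpace ℂ (Fin N) → Fin K) : Prop :=
  Measurable d ∧ ∀ᵐ ω ∂μ, ∀ j,
    (μ⟦k ⁻¹' {j} | sampleSigma y N⟧) ω ≤ (μ⟦k ⁻¹' {d (batch y N ω)} | sampleSigma y N⟧) ω

/-- The exact MMSE estimator `E[s | y]` from the first `N` samples of `y`. -/
def mmseEstimator {Ω : Type*} [MeasurableSpace Ω] (μ : Measure Ω)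
    (s y : ℕ → Ω → ℂ) (N : ℕ) : Ω → EuclideanSpace ℂ (Fin N) :=
  μ[batch s N | sampleSigma y N]

/-- The detect-then-separate estimator: the LMMSE estimator of the detected type. -/
def dtsEstimator {Ω : Type*} {K : ℕ} (Cs : Matrix ℕ ℕ ℂ) (Cb : Fin K → Matrix ℕ ℕ ℂ)
    (y : ℕ → Ω → ℂ) (N : ℕ) (d : EuclideanSpace ℂ (Fin N) → Fin K) :
    Ω → EuclideanSpace ℂ (Fin N) :=
  fun ω => lmmse Cs (Cb (d (batch y N ω))) N (batch y N ω)

/-- The mean-square error of an estimator of the first `N` samples of `s`. -/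
def mse {Ω : Type*} [MeasurableSpace Ω] (μ : Measure Ω) (s : ℕ → Ω → ℂ) (N : ℕ)
    (est : Ω → EuclideanSpace ℂ (Fin N)) : ℝ :=
  ∫ ω, ‖est ω - batch s N ω‖ ^ 2 ∂μ

end DTS

end

/-!
The comparison runs through the genie-aided estimator, which is told the type and applies the
corresponding linear MMSE estimator. Given the type, its error is jointly Gaussian with the
observation and uncorrelated with it, hence independent of it. Every estimator that is a function
of the observation therefore has the mean-square error of the genie-aided estimator plus its
mean-square distance to that estimator (`mse_eq_genieError_add`). Writing `G` for the genie-aided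
error and `D` for the distance of detect-then-separate to it, this gives
`G ≤ mse(MMSE) ≤ mse(DTS) = G + D`. The white-noise floor and the unit variance of the signal keep
`G` bounded below (`exists_genieError_ge`), so it suffices that `D` tends to zero.

The two estimators coincide unless the detector errs, and the linear estimators have norm at most of
order `N`. So `D` tends to zero once the detection errors have probability of order `N ^ (-8)`
(`exists_genieDistance_dtsMap_le`). A MAP detector confuses two types with at most the sum of the
two error probabilities of an arbitrary test between them (`IsMAPDetector.measureReal_confusion_le`),
and it remains to find a good test from the temporal-diversity condition, which by itself says only
that `|ψ|` is away from zero with probability tending to one, with no rate.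

Simultaneous diagonalization of the two covariance matrices turns the pair of types into the
standard normal law on `ℝ ^ n`, `n = 2 N`, against independent normal variables of variances
`1 / a i`, and turns `ψ + 1` into the mean of the terms `a i * x i ^ 2`, where `∑ i, a i = O(n)`
(`exists_test`). Two cases give the rate. If sufficiently many `a i` exceed `√n`, these coordinates
alone distinguish the laws: each of them is tiny under the second law, and equally tiny under the
first one only with probability at most a negative power of `n`. Otherwise the sum over
the remaining coordinates is sharply concentrated under both laws, by a Chernoff bound. Under the
second law it is concentrated at about `1`. Under the first law the finitely many large terms are
simultaneously negligible with probability bounded below, so that `ψ` could not avoid a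
neighbourhood of zero with probability close to one unless the concentration point is away from `1`.
-/

namespace DTS

/-! ### Quadratic forms in independent standard normal variables -/

/-- The law of a family of independent real standard normal variables. -/
noncomputable abbrev stdNormal (ι : Type*) [Fintype ι] : Measure (ι → ℝ) :=
  Measure.pi fun _ => gaussianReal 0 1

/-- For `1 / 2 ≤ θ` the integral diverges, and both sides have the junk value `0`. -/
lemma integral_exp_mul_sq_gaussianReal (θ : ℝ) :
    ∫ x, Real.exp (θ * x ^ 2) ∂gaussianReal 0 1 = (√(1 - 2 * θ))⁻¹ := by
  rw [integral_gaussianReal_eq_integral_smul (by norm_num)]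
  have h : ∀ x : ℝ, gaussianPDFReal 0 1 x • Real.exp (θ * x ^ 2)
      = (√(2 * Real.pi))⁻¹ * Real.exp (-(1 / 2 - θ) * x ^ 2) := by
    intro x
    simp only [gaussianPDFReal, smul_eq_mul, NNReal.coe_one, mul_one, sub_zero]
    rw [mul_assoc, ← Real.exp_add]
    ring_nf
  simp_rw [h]
  rw [integral_const_mul, integral_gaussian, ← Real.sqrt_inv, ← Real.sqrt_inv,
    ← Real.sqrt_mul (by positivity)]
  congr 1
  have := Real.pi_pos
  rw [show 1 / 2 - θ = (1 - 2 * θ) / 2 by ring]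
  by_cases h : 1 - 2 * θ = 0
  · simp [h]
  · field_simp

lemma integrable_exp_mul_sq_gaussianReal {θ : ℝ} (hθ : |θ| ≤ 1 / 4) :
    Integrable (fun x => Real.exp (θ * x ^ 2)) (gaussianReal 0 1) := by
  -- a non-integrable function has integral `0`, whereas the value computed above is positive
  by_contra h
  have h1 := integral_exp_mul_sq_gaussianReal θ
  rw [integral_undef h] at h1
  have : 0 < (√(1 - 2 * θ))⁻¹ := by
    have := (abs_le.1 hθ).2
    exact inv_pos.2 (Real.sqrt_pos.2 (by linarith))
  linarith

lemma integral_exp_mul_sq_gaussianReal_le {θ : ℝ} (hθ : |θ| ≤ 1 / 4) :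
    ∫ x, Real.exp (θ * x ^ 2) ∂gaussianReal 0 1 ≤ Real.exp (θ + 4 * θ ^ 2) := by
  obtain ⟨h1, h2⟩ := abs_le.1 hθ
  have hpos : 0 < 1 - 2 * θ := by linarith
  rw [integral_exp_mul_sq_gaussianReal, ← Real.sqrt_inv]
  apply Real.sqrt_le_iff.2 ⟨by positivity, ?_⟩
  rw [← Real.exp_nat_mul]
  have h3 : (1 - 2 * θ)⁻¹ = 2 * θ / (1 - 2 * θ) + 1 := by field_simp; ring
  rw [h3]
  refine (Real.add_one_le_exp _).trans (Real.exp_le_exp.2 ?_)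
  rw [div_le_iff₀ hpos]
  push_cast
  nlinarith [mul_nonneg (sq_nonneg θ) (by linarith : 0 ≤ 1 / 4 - θ)]

/-- The moment generating function of a centred weighted sum of squares is subgaussian for
parameters `θ` that are small compared to `1 / W`. -/
lemma integral_exp_weighted_sq_le {ι : Type*} [Fintype ι] {w : ι → ℝ} {W B θ : ℝ} (hW : 0 ≤ W)
    (hw0 : ∀ i, 0 ≤ w i) (hwW : ∀ i, w i ≤ W) (hwB : ∑ i, w i ≤ B) (hθ : |θ| * W ≤ 1 / 4) :
    Integrable (fun x : ι → ℝ => Real.exp (θ * (∑ i, w i * x i ^ 2 - ∑ i, w i))) (stdNormal ι) ∧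
    ∫ x, Real.exp (θ * (∑ i, w i * x i ^ 2 - ∑ i, w i)) ∂stdNormal ι
      ≤ Real.exp (4 * θ ^ 2 * (W * B)) := by
  have hθw : ∀ i, |θ * w i| ≤ 1 / 4 := fun i => by
    rw [abs_mul, abs_of_nonneg (hw0 i)]
    exact (mul_le_mul_of_nonneg_left (hwW i) (abs_nonneg _)).trans hθ
  have hprod : ∀ x : ι → ℝ, Real.exp (θ * (∑ i, w i * x i ^ 2 - ∑ i, w i))
      = ∏ i, (Real.exp (-(θ * w i)) * Real.exp (θ * w i * x i ^ 2)) := by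
    intro x
    simp_rw [← Real.exp_add]
    rw [← Real.exp_sum, ← Finset.sum_sub_distrib, Finset.mul_sum]
    congr 1
    exact Finset.sum_congr rfl fun i _ => by ring
  simp_rw [hprod]
  refine ⟨Integrable.fintype_prod (f := fun i y =>
    Real.exp (-(θ * w i)) * Real.exp (θ * w i * y ^ 2)) fun i =>
    (integrable_exp_mul_sq_gaussianReal (hθw i)).const_mul _, ?_⟩
  rw [integral_fintype_prod_eq_prod (f := fun i y =>
    Real.exp (-(θ * w i)) * Real.exp (θ * w i * y ^ 2))]
  calc _ ≤ ∏ i, Real.exp (4 * (θ * w i) ^ 2) := by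
        refine Finset.prod_le_prod (fun i _ => integral_nonneg fun y => by positivity) fun i _ => ?_
        rw [integral_const_mul]
        refine (mul_le_mul_of_nonneg_left (integral_exp_mul_sq_gaussianReal_le (hθw i))
          (Real.exp_pos _).le).trans_eq ?_
        rw [← Real.exp_add]; ring_nf
    _ = Real.exp (4 * θ ^ 2 * ∑ i, w i * w i) := by
        rw [← Real.exp_sum, Finset.mul_sum]
        congr 1
        exact Finset.sum_congr rfl fun i _ => by ring
    _ ≤ _ := by
        refine Real.exp_le_exp.2 (mul_le_mul_of_nonneg_left ?_ (by positivity))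
        calc ∑ i, w i * w i ≤ ∑ i, W * w i :=
              Finset.sum_le_sum fun i _ => mul_le_mul_of_nonneg_right (hwW i) (hw0 i)
          _ = W * ∑ i, w i := by rw [Finset.mul_sum]
          _ ≤ W * B := mul_le_mul_of_nonneg_left hwB hW

/-- Chernoff bound: a weighted sum of squares of independent standard normal variables with weights
at most `W` and total weight at most `B` deviates from its mean by `t` with probability exponentially
small in `1 / W`. -/
lemma measure_weighted_sq_dev_le {ι : Type*} [Fintype ι] {w : ι → ℝ} {W B t : ℝ} (hW : 0 < W)
    (hB : 0 < B) (ht : 0 < t) (hw0 : ∀ i, 0 ≤ w i) (hwW : ∀ i, w i ≤ W) (hwB : ∑ i, w i ≤ B) :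
    (stdNormal ι).real {x | t ≤ |∑ i, w i * x i ^ 2 - ∑ i, w i|}
      ≤ 2 * Real.exp (-(min (1 / 4) (t / (8 * B)) * t / (2 * W))) := by
  set τ := min (1 / 4) (t / (8 * B)) with hτ
  have hτ0 : 0 < τ := lt_min (by norm_num) (by positivity)
  have hτ1 : τ ≤ 1 / 4 := min_le_left _ _
  have hτ2 : 8 * B * τ ≤ t := by
    have : τ ≤ t / (8 * B) := min_le_right _ _
    rwa [le_div_iff₀ (by positivity), mul_comm] at this
  have key : ∀ η : ℝ, |η| = τ / W →
      (stdNormal ι).real {x | τ / W * t ≤ η * (∑ i, w i * x i ^ 2 - ∑ i, w i)}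
        ≤ Real.exp (-(τ * t / (2 * W))) := by
    intro η hη
    have hηW : |η| * W ≤ 1 / 4 := by rw [hη]; field_simp; linarith
    obtain ⟨hi, hle⟩ := integral_exp_weighted_sq_le (θ := η) hW.le hw0 hwW hwB hηW
    have hm := mul_meas_ge_le_integral_of_nonneg (ae_of_all _ fun x => (Real.exp_pos _).le) hi
      (Real.exp (τ / W * t))
    simp only [Real.exp_le_exp] at hm
    have h1 := hm.trans hle
    rw [mul_comm, ← le_div_iff₀ (Real.exp_pos _), ← Real.exp_sub] at h1
    refine h1.trans (Real.exp_le_exp.2 ?_)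
    rw [← sq_abs, hη]
    have : 4 * (τ / W) ^ 2 * (W * B) - τ / W * t + τ * t / (2 * W)
        = τ / (2 * W) * (8 * B * τ - t) := by field_simp; ring
    nlinarith [mul_nonneg (by positivity : 0 ≤ τ / (2 * W)) (sub_nonneg.2 hτ2)]
  have hsub : {x : ι → ℝ | t ≤ |∑ i, w i * x i ^ 2 - ∑ i, w i|} ⊆
      {x | τ / W * t ≤ τ / W * (∑ i, w i * x i ^ 2 - ∑ i, w i)} ∪
      {x | τ / W * t ≤ -(τ / W) * (∑ i, w i * x i ^ 2 - ∑ i, w i)} := by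
    intro x hx
    have hpos : 0 ≤ τ / W := by positivity
    rcases le_abs.1 (show t ≤ |_| from hx) with h | h
    · exact Or.inl (mul_le_mul_of_nonneg_left h hpos)
    · refine Or.inr ?_
      simp only [Set.mem_ofPred_eq]
      rw [neg_mul_comm]
      exact mul_le_mul_of_nonneg_left h hpos
  have hpos : 0 < τ / W := by positivity
  calc _ ≤ _ := measureReal_mono hsub
    _ ≤ _ := measureReal_union_le _ _
    _ ≤ _ := add_le_add (key _ (abs_of_pos hpos)) (key _ (by rw [abs_neg, abs_of_pos hpos]))
    _ = _ := by ring

lemma gaussianReal_sq_le_real_le {r : ℝ} :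
    (gaussianReal 0 1).real {x | x ^ 2 ≤ r} ≤ 2 * √r := by
  have hsub : {x : ℝ | x ^ 2 ≤ r} ⊆ Set.Icc (-√r) (√r) := fun x hx =>
    abs_le.1 (Real.abs_le_sqrt hx)
  refine (measureReal_mono hsub).trans ?_
  rw [measureReal_def, gaussianReal_apply_eq_integral 0 (by norm_num),
    ENNReal.toReal_ofReal (integral_nonneg fun x => gaussianPDFReal_nonneg _ _ _)]
  have hle : ∀ x, gaussianPDFReal 0 1 x ≤ 1 := by
    intro x
    rw [gaussianPDFReal]
    refine mul_le_one₀ (inv_le_one_of_one_le₀ ?_) (Real.exp_pos _).le (Real.exp_le_one_iff.2 ?_)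
    · rw [Real.one_le_sqrt]
      have := Real.pi_gt_three
      norm_num; linarith
    · have := sq_nonneg x
      norm_num; linarith
  calc _ ≤ ∫ x in Set.Icc (-√r) (√r), (1 : ℝ) :=
        setIntegral_mono (integrable_gaussianPDFReal 0 1).integrableOn (by simp) hle
    _ = 2 * √r := by
        simp [Real.sqrt_nonneg, two_mul]

lemma gaussianReal_sq_le_real_pos {r : ℝ} (hr : 0 < r) :
    0 < (gaussianReal 0 1).real {x | x ^ 2 ≤ r} := by
  rw [measureReal_def, ENNReal.toReal_pos_iff]
  refine ⟨pos_iff_ne_zero.2 fun h => ?_, measure_lt_top _ _⟩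
  have h1 := gaussianReal_absolutelyContinuous' 0 (v := 1) one_ne_zero h
  have h2 : volume (Set.Ioo (-√r) (√r)) = 0 := by
    refine measure_mono_null (fun x hx => ?_) h1
    have : |x| ≤ √r := (abs_lt.2 hx).le
    simpa [sq_abs] using (Real.le_sqrt (abs_nonneg x) hr.le).1 this
  have := Real.sqrt_pos.2 hr
  simp at h2
  linarith

lemma gaussianReal_sq_gt_real_le (t : ℝ) :
    (gaussianReal 0 1).real {x | t < x ^ 2} ≤ 2 * Real.exp (-(t / 4)) := by
  have hm := mul_meas_ge_le_integral_of_nonneg (ae_of_all _ fun x => (Real.exp_pos _).le)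
    (integrable_exp_mul_sq_gaussianReal (θ := 1 / 4) (by norm_num [abs_of_pos])) (Real.exp (1 / 4 * t))
  simp only [Real.exp_le_exp] at hm
  rw [integral_exp_mul_sq_gaussianReal] at hm
  have h2 : (√(1 - 2 * (1 / 4) : ℝ))⁻¹ ≤ 2 := by
    rw [inv_le_comm₀ (Real.sqrt_pos.2 (by norm_num)) (by norm_num)]
    exact Real.le_sqrt_of_sq_le (by norm_num)
  have h3 : (gaussianReal 0 1).real {x | t < x ^ 2}
      ≤ (gaussianReal 0 1).real {x : ℝ | 1 / 4 * t ≤ 1 / 4 * x ^ 2} :=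
    measureReal_mono fun x (hx : t < x ^ 2) => by simp only [Set.mem_ofPred_eq]; linarith
  rw [Real.exp_neg, ← div_eq_mul_inv, le_div_iff₀ (Real.exp_pos _)]
  calc _ ≤ _ := mul_le_mul_of_nonneg_right h3 (Real.exp_pos _).le
    _ = Real.exp (1 / 4 * t) * (gaussianReal 0 1).real {x : ℝ | 1 / 4 * t ≤ 1 / 4 * x ^ 2} := by
        rw [mul_comm]; congr 2; ring
    _ ≤ 2 := hm.trans h2

lemma stdNormal_real_forall_mem {ι : Type*} [Fintype ι] (T : Finset ι) (A : ι → Set ℝ) :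
    (stdNormal ι).real {x | ∀ i ∈ T, x i ∈ A i} = ∏ i ∈ T, (gaussianReal 0 1).real (A i) := by
  classical
  have : {x : ι → ℝ | ∀ i ∈ T, x i ∈ A i}
      = Set.univ.pi fun i => if i ∈ T then A i else Set.univ := by
    ext x
    simp only [Set.mem_ofPred_eq, Set.mem_pi, Set.mem_univ, true_imp_iff]
    refine forall_congr' fun i => ?_
    split_ifs with h <;> simp [h]
  rw [this, measureReal_def, Measure.pi_pi, ENNReal.toReal_prod, ← Finset.prod_subset T.subset_univ]
  · exact Finset.prod_congr rfl fun i hi => by simp [hi, measureReal_def]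
  · intro i _ hi
    simp [hi]

/-- All the requirements on the eighth root `h` of the dimension that the construction of the
test needs hold for large `h`. -/
lemma eventually_test_thresholds (q m : ℕ) {c κ p : ℝ} (hc : 0 < c) (hκ : 0 < κ) (hp : 0 < p) :
    ∀ᶠ h : ℝ in atTop, 1 ≤ h ∧ 2 ^ m ≤ h ∧ m * (2 * Real.exp (-(h ^ 2 / 4))) ≤ (h ^ (8 * q))⁻¹ ∧
      2 * Real.exp (-(κ * h ^ 4)) ≤ (h ^ (8 * q))⁻¹ ∧ 2 * Real.exp (-(κ * h ^ 4)) < p ∧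
      m / h ^ 8 ≤ c / 16 := by
  have hexp : ∀ (C b : ℝ) (r j : ℕ), 0 < b → j ≠ 0 →
      Tendsto (fun h : ℝ => h ^ r * (C * Real.exp (-(b * h ^ j)))) atTop (𝓝 0) := by
    intro C b r j hb hj
    have h0 := ((tendsto_rpow_mul_exp_neg_mul_atTop_nhds_zero r b hb).const_mul |C|)
    simp only [mul_zero, Real.rpow_natCast] at h0
    refine squeeze_zero_norm' ?_ h0
    filter_upwards [eventually_ge_atTop 1] with h h1
    rw [norm_mul, norm_mul, Real.norm_eq_abs, Real.norm_eq_abs, Real.norm_eq_abs, Real.abs_exp,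
      abs_of_nonneg (by positivity)]
    have : b * h ≤ b * h ^ j := mul_le_mul_of_nonneg_left (le_self_pow₀ h1 hj) hb.le
    have : Real.exp (-(b * h ^ j)) ≤ Real.exp (-b * h) := Real.exp_le_exp.2 (by linarith)
    calc _ = |C| * (h ^ r * Real.exp (-(b * h ^ j))) := by ring
      _ ≤ _ := by gcongr
  have hinv : ∀ (C b : ℝ) (j : ℕ), 0 < b → j ≠ 0 →
      ∀ᶠ h : ℝ in atTop, C * Real.exp (-(b * h ^ j)) ≤ (h ^ (8 * q))⁻¹ := by
    intro C b j hb hj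
    filter_upwards [(hexp C b (8 * q) j hb hj).eventually (gt_mem_nhds one_pos),
      eventually_gt_atTop 0] with h h1 h2
    rw [← one_div, le_div_iff₀ (by positivity), mul_comm]
    exact h1.le
  have h5 : Tendsto (fun h : ℝ => (m : ℝ) / h ^ 8) atTop (𝓝 0) :=
    tendsto_const_nhds.div_atTop (tendsto_pow_atTop (by norm_num))
  filter_upwards [eventually_ge_atTop 1, eventually_ge_atTop ((2 : ℝ) ^ m),
    hinv (m * 2) (1 / 4) 2 (by norm_num) (by norm_num), hinv 2 κ 4 hκ (by norm_num),
    (hexp 2 κ 0 4 hκ (by norm_num)).eventually (gt_mem_nhds hp),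
    h5.eventually (gt_mem_nhds (show 0 < c / 16 by positivity))] with h g1 g2 g3 g4 g5 g6
  refine ⟨g1, g2, ?_, g4, by simpa using g5, g6.le⟩
  rw [← mul_assoc, show h ^ 2 / 4 = 1 / 4 * h ^ 2 by ring]
  exact g3

/-- If `m` of the weights `a i` exceed the square root `h ^ 4` of the dimension, then the event that
all the corresponding `a i * x i ^ 2` are at most `h ^ 2` distinguishes the standard normal law from
the law with variances `1 / a i`. -/
lemma exists_test_of_large_weights {ι : Type*} [Fintype ι] {q m : ℕ} {h : ℝ} (hm : m = 8 * q + 1)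
    (h1 : 1 ≤ h) (h2 : 2 ^ m ≤ h) (h3 : m * (2 * Real.exp (-(h ^ 2 / 4))) ≤ (h ^ (8 * q))⁻¹)
    {a : ι → ℝ} (ha : ∀ i, 0 < a i) {T : Finset ι} (hT : T.card = m)
    (hTa : ∀ i ∈ T, h ^ 4 < a i) :
    ∃ G : Set (ι → ℝ), MeasurableSet G ∧ (stdNormal ι).real G ≤ (h ^ (8 * q))⁻¹ ∧
      (stdNormal ι).real {x | (fun i => x i / √(a i)) ∉ G} ≤ (h ^ (8 * q))⁻¹ := by
  have h0 : 0 < h := by linarith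
  refine ⟨{x | ∀ i ∈ T, x i ∈ {y : ℝ | a i * y ^ 2 ≤ h ^ 2}}, ?_, ?_, ?_⟩
  · have : {x : ι → ℝ | ∀ i ∈ T, x i ∈ {y : ℝ | a i * y ^ 2 ≤ h ^ 2}}
        = ⋂ i ∈ T, {x | a i * x i ^ 2 ≤ h ^ 2} := by ext; simp
    rw [this]
    exact Finset.measurableSet_biInter _ fun i _ => measurableSet_le (by fun_prop) (by fun_prop)
  · rw [stdNormal_real_forall_mem]
    have hone : ∀ i ∈ T, (gaussianReal 0 1).real {y : ℝ | a i * y ^ 2 ≤ h ^ 2} ≤ 2 / h := by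
      intro i hi
      refine (measureReal_mono (s₂ := {y : ℝ | y ^ 2 ≤ (1 / h) ^ 2}) fun y hy => ?_).trans
        (gaussianReal_sq_le_real_le.trans_eq ?_)
      · simp only [Set.mem_ofPred_eq] at hy ⊢
        have := mul_le_mul_of_nonneg_right (hTa i hi).le (sq_nonneg y)
        rw [one_div, inv_pow, ← one_div, le_div_iff₀ (by positivity)]
        have h4 : h ^ 2 * (y ^ 2 * h ^ 2) ≤ h ^ 2 * 1 := by nlinarith
        exact le_of_mul_le_mul_left h4 (by positivity)
      · rw [Real.sqrt_sq (by positivity)]; ring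
    refine (Finset.prod_le_prod (fun _ _ => measureReal_nonneg) hone).trans ?_
    rw [Finset.prod_const, hT, div_pow, hm, pow_succ h, ← hm]
    rw [div_le_iff₀ (by positivity)]
    field_simp
    exact h2
  · have hsub : {x : ι → ℝ | (fun i => x i / √(a i)) ∉
        {x : ι → ℝ | ∀ i ∈ T, x i ∈ {y : ℝ | a i * y ^ 2 ≤ h ^ 2}}}
        ⊆ ⋃ i ∈ T, {x | ∀ j ∈ ({i} : Finset ι), x j ∈ {y : ℝ | h ^ 2 < y ^ 2}} := by
      intro x hx
      simp only [Set.mem_ofPred_eq, not_forall, not_le] at hx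
      obtain ⟨i, hi, hlt⟩ := hx
      rw [div_pow, Real.sq_sqrt (ha i).le, mul_div_cancel₀ _ (ha i).ne'] at hlt
      simp only [Set.mem_iUnion]
      exact ⟨i, hi, by simpa using hlt⟩
    refine (measureReal_mono hsub (measure_ne_top _ _)).trans ((measureReal_biUnion_finset_le _ _).trans ?_)
    refine (Finset.sum_le_sum fun i _ => (stdNormal_real_forall_mem {i} _).le).trans ?_
    simp only [Finset.prod_singleton]
    refine (Finset.sum_le_sum fun i _ => gaussianReal_sq_gt_real_le (h ^ 2)).trans ?_
    rw [Finset.sum_const, hT, nsmul_eq_mul]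
    exact h3

/-- If fewer than `m` of the weights are large, then the sum over the other weights is sharply
concentrated under both laws. The few large terms are simultaneously negligible with a probability
bounded below, so that the full quadratic form can only avoid a neighbourhood of `1` with high
probability if the mean of the remaining sum is away from `1`; hence this sum is a test. -/
lemma exists_test_of_few_large_weights {ι : Type*} [Fintype ι] {q m : ℕ} {h c B p κ : ℝ}
    (hn : (Fintype.card ι : ℝ) = h ^ 8) (hm : 0 < m) (h1 : 1 ≤ h) (hc : 0 < c) (hB : 1 ≤ B)
    (hp : p = (gaussianReal 0 1).real {y | y ^ 2 ≤ c / (4 * m * B)} ^ m)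
    (hκ : κ = min (1 / 4) (c / 16 / (8 * B)) * (c / 16) / 2)
    (h4 : 2 * Real.exp (-(κ * h ^ 4)) ≤ (h ^ (8 * q))⁻¹)
    (h5 : 2 * Real.exp (-(κ * h ^ 4)) < p / 2) (h6 : m / h ^ 8 ≤ c / 16)
    {a : ι → ℝ} (ha : ∀ i, 0 < a i) (haB : ∑ i, a i ≤ B * Fintype.card ι)
    (hfew : (Finset.univ.filter fun i => h ^ 4 < a i).card ≤ m)
    (hQ : (stdNormal ι).real {x | |(∑ i, a i * x i ^ 2) / Fintype.card ι - 1| < c} ≤ p / 2) :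
    ∃ G : Set (ι → ℝ), MeasurableSet G ∧ (stdNormal ι).real G ≤ (h ^ (8 * q))⁻¹ ∧
      (stdNormal ι).real {x | (fun i => x i / √(a i)) ∉ G} ≤ (h ^ (8 * q))⁻¹ := by
  have h0 : 0 < h := by linarith
  have hh8 : 0 < h ^ 8 := by positivity
  rw [hn] at haB
  simp only [hn] at hQ
  set big := Finset.univ.filter fun i => h ^ 4 < a i with hbig
  set w : ι → ℝ := fun i => if h ^ 4 < a i then 0 else a i / h ^ 8 with hw
  set v : ι → ℝ := fun i => if h ^ 4 < a i then 0 else 1 / h ^ 8 with hv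
  have hw0 : ∀ i, 0 ≤ w i := fun i => by
    simp only [hw]; split_ifs
    · rfl
    · exact div_nonneg (ha i).le hh8.le
  have hv0 : ∀ i, 0 ≤ v i := fun i => by simp only [hv]; split_ifs <;> positivity
  have hwW : ∀ i, w i ≤ 1 / h ^ 4 := fun i => by
    simp only [hw]; split_ifs with hi
    · positivity
    · rw [div_le_div_iff₀ hh8 (by positivity)]
      calc a i * h ^ 4 ≤ h ^ 4 * h ^ 4 := by gcongr; exact not_lt.1 hi
        _ = 1 * h ^ 8 := by ring
  have hvW : ∀ i, v i ≤ 1 / h ^ 4 := fun i => by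
    simp only [hv]; split_ifs with hi
    · positivity
    · exact one_div_le_one_div_of_le (by positivity) (pow_le_pow_right₀ h1 (by norm_num))
  have hwB : ∑ i, w i ≤ B := by
    calc ∑ i, w i ≤ ∑ i, a i / h ^ 8 := Finset.sum_le_sum fun i _ => by
          simp only [hw]; split_ifs
          · exact div_nonneg (ha i).le hh8.le
          · rfl
      _ ≤ B := by rw [← Finset.sum_div, div_le_iff₀ hh8]; exact haB
  have hvsum : ∑ i, v i = 1 - big.card / h ^ 8 := by
    have hcard : (big.card : ℝ) + (Finset.univ.filter fun i => ¬ h ^ 4 < a i).card = h ^ 8 := by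
      rw [← hn, ← Nat.cast_add, hbig, Finset.card_filter_add_card_filter_not, Finset.card_univ]
    simp only [hv, Finset.sum_ite, Finset.sum_const_zero, zero_add, Finset.sum_const, nsmul_eq_mul]
    field_simp
    linarith
  have hcardbig : (big.card : ℝ) / h ^ 8 ≤ c / 16 :=
    (div_le_div_of_nonneg_right (by exact_mod_cast hfew) hh8.le).trans h6
  have hvB : ∑ i, v i ≤ B := by
    rw [hvsum]; have : 0 ≤ (big.card : ℝ) / h ^ 8 := by positivity
    linarith
  have hdev : ∀ u : ι → ℝ, (∀ i, 0 ≤ u i) → (∀ i, u i ≤ 1 / h ^ 4) → ∑ i, u i ≤ B →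
      (stdNormal ι).real {x | c / 16 ≤ |∑ i, u i * x i ^ 2 - ∑ i, u i|}
        ≤ 2 * Real.exp (-(κ * h ^ 4)) := by
    intro u hu0 huW huB
    refine (measure_weighted_sq_dev_le (by positivity) (by linarith) (by positivity)
      hu0 huW huB).trans_eq ?_
    rw [hκ]; congr 3; field_simp
  -- otherwise the full sum would be within `c` of `1` with a probability exceeding `p / 2`
  have hmean : c / 4 ≤ |∑ i, w i - 1| := by
    by_contra! hlt
    set r := c / (4 * m * B) with hr
    have hA := stdNormal_real_forall_mem big fun _ => {y : ℝ | y ^ 2 ≤ r}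
    rw [Finset.prod_const] at hA
    have hpA : p ≤ (stdNormal ι).real {x | ∀ i ∈ big, x i ∈ {y : ℝ | y ^ 2 ≤ r}} := by
      rw [hA, hp]
      exact pow_le_pow_of_le_one measureReal_nonneg measureReal_le_one hfew
    have hsub : {x : ι → ℝ | ∀ i ∈ big, x i ∈ {y : ℝ | y ^ 2 ≤ r}} ⊆
        {x | |(∑ i, a i * x i ^ 2) / h ^ 8 - 1| < c} ∪
        {x | c / 16 ≤ |∑ i, w i * x i ^ 2 - ∑ i, w i|} := by
      intro x hx
      by_contra hcon
      simp only [Set.mem_union, Set.mem_ofPred_eq, not_or, not_lt, not_le] at hcon hx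
      obtain ⟨hc1, hc2⟩ := hcon
      have hsplit : (∑ i, a i * x i ^ 2) / h ^ 8
          = ∑ i ∈ big, a i / h ^ 8 * x i ^ 2 + ∑ i, w i * x i ^ 2 := by
        rw [hbig, Finset.sum_filter, ← Finset.sum_add_distrib, Finset.sum_div]
        refine Finset.sum_congr rfl fun i _ => ?_
        simp only [hw]
        split_ifs <;> ring
      have hbig0 : 0 ≤ ∑ i ∈ big, a i / h ^ 8 * x i ^ 2 :=
        Finset.sum_nonneg fun i _ => mul_nonneg (div_nonneg (ha i).le hh8.le) (sq_nonneg _)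
      have hbig1 : ∑ i ∈ big, a i / h ^ 8 * x i ^ 2 ≤ c / 4 := by
        calc _ ≤ ∑ i ∈ big, B * r := Finset.sum_le_sum fun i hi => by
              refine mul_le_mul ?_ (hx i hi) (sq_nonneg _) (by linarith)
              rw [div_le_iff₀ hh8]
              exact (Finset.single_le_sum (fun j _ => (ha j).le) (Finset.mem_univ i)).trans haB
          _ = big.card * (B * r) := by rw [Finset.sum_const, nsmul_eq_mul]
          _ ≤ m * (B * r) := by
              have : 0 ≤ B * r := by positivity
              gcongr
          _ = c / 4 := by
              have : (m : ℝ) ≠ 0 := by positivity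
              rw [hr]; field_simp
      rw [hsplit] at hc1
      rw [abs_lt] at hlt hc2
      rcases le_abs.1 hc1 with h7 | h7 <;> linarith
    have h8 := (measureReal_mono hsub).trans (measureReal_union_le (μ := stdNormal ι) _ _)
    have h9 := hdev w hw0 hwW hwB
    linarith
  refine ⟨{x | |∑ i, w i * x i ^ 2 - 1| < c / 8}, ?_, ?_, ?_⟩
  · exact measurableSet_lt (by fun_prop) (by fun_prop)
  · refine (measureReal_mono (fun x hx => ?_)).trans ((hdev w hw0 hwW hwB).trans h4)
    simp only [Set.mem_ofPred_eq, abs_lt] at hx ⊢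
    rcases le_abs.1 hmean with h7 | h7
    · exact le_abs.2 (Or.inr (by linarith))
    · exact le_abs.2 (Or.inl (by linarith))
  · refine (measureReal_mono (fun x hx => ?_)).trans ((hdev v hv0 hvW hvB).trans h4)
    have hvw : ∑ i, w i * (x i / √(a i)) ^ 2 = ∑ i, v i * x i ^ 2 := by
      refine Finset.sum_congr rfl fun i _ => ?_
      rw [div_pow, Real.sq_sqrt (ha i).le]
      have := (ha i).ne'
      simp only [hw, hv]
      split_ifs
      · ring
      · field_simp
    simp only [Set.mem_ofPred_eq, not_lt, hvw] at hx ⊢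
    have : 0 ≤ (big.card : ℝ) / h ^ 8 := by positivity
    rw [hvsum]
    rcases le_abs.1 hx with h7 | h7
    · exact le_abs.2 (Or.inl (by linarith))
    · exact le_abs.2 (Or.inr (by linarith))

/-- Suppose that the mean square of `√(a i) * x i` avoids a neighbourhood of `1` with a probability
close enough to one for standard normal `x`. Then there is a test between the standard normal law
and the law of independent centred normal variables with variances `1 / a i` whose two error
probabilities are both at most any prescribed power of `1 / n`, in a large dimension `n`. -/
theorem exists_test (q : ℕ) {c B : ℝ} (hc : 0 < c) (hB : 1 ≤ B) :
    ∃ ε : ℝ, 0 < ε ∧ ∀ᶠ n : ℕ in atTop, ∀ (ι : Type) [Fintype ι], Fintype.card ι = n →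
      ∀ a : ι → ℝ, (∀ i, 0 < a i) → ∑ i, a i ≤ B * n →
      (stdNormal ι).real {x | |(∑ i, a i * x i ^ 2) / n - 1| < c} ≤ ε →
      ∃ G : Set (ι → ℝ), MeasurableSet G ∧ (stdNormal ι).real G ≤ ((n : ℝ) ^ q)⁻¹ ∧
        (stdNormal ι).real {x | (fun i => x i / √(a i)) ∉ G} ≤ ((n : ℝ) ^ q)⁻¹ := by
  -- each of `m` large weights contributes a factor `2 / h` to an error probability, where
  -- `h = n ^ (1 / 8)`, so `8 * q + 1` of them suffice to beat `n ^ (-q) = h ^ (-8 * q)`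
  set m := 8 * q + 1 with hm
  set p := (gaussianReal 0 1).real {y | y ^ 2 ≤ c / (4 * m * B)} ^ m with hp
  have hm0 : (0 : ℝ) < m := by positivity
  have hp0 : 0 < p := pow_pos (gaussianReal_sq_le_real_pos (by positivity)) _
  set κ := min (1 / 4) (c / 16 / (8 * B)) * (c / 16) / 2 with hκ
  have hκ0 : 0 < κ := by
    have : 0 < min (1 / 4) (c / 16 / (8 * B)) := lt_min (by norm_num) (by positivity)
    positivity
  refine ⟨p / 2, by positivity, ?_⟩
  have hroot : Tendsto (fun n : ℕ => (n : ℝ) ^ (1 / 8 : ℝ)) atTop atTop :=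
    (tendsto_rpow_atTop (by norm_num)).comp tendsto_natCast_atTop_atTop
  filter_upwards [hroot.eventually
    (eventually_test_thresholds q m hc hκ0 (show 0 < p / 2 by positivity))] with n hn ι _ hcard a
    ha haB hQ
  set h := (n : ℝ) ^ (1 / 8 : ℝ) with hh
  obtain ⟨h1, h2, h3, h4, h5, h6⟩ := hn
  have hn8 : (n : ℝ) = h ^ 8 := by
    rw [hh, ← Real.rpow_natCast, ← Real.rpow_mul n.cast_nonneg]; norm_num
  have hnq : (n : ℝ) ^ q = h ^ (8 * q) := by rw [hn8, pow_mul]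
  rw [hnq]
  by_cases hfew : (Finset.univ.filter fun i => h ^ 4 < a i).card ≤ m
  · subst hcard
    exact exists_test_of_few_large_weights hn8 (by omega) h1 hc hB hp hκ h4 h5 h6 ha haB hfew hQ
  · obtain ⟨T, hTsub, hT⟩ := Finset.exists_subset_card_eq (not_le.1 hfew).le
    exact exists_test_of_large_weights hm h1 h2 h3 ha hT fun i hi =>
      (Finset.mem_filter.1 (hTsub hi)).2

/-! ### Circularly symmetric complex Gaussian vectors -/

/-- The random vector `X` is zero-mean circularly symmetric complex Gaussian with covariance matrix
`C i j = E[X i * conj (X j)]`. -/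
structure IsCircularGaussian {Ω ι : Type*} [MeasurableSpace Ω] [Fintype ι]
    (X : Ω → ι → ℂ) (C : Matrix ι ι ℂ) (P : Measure Ω) : Prop where
  gaussian : HasGaussianLaw X P
  mean_zero : ∀ i, ∫ ω, X ω i ∂P = 0
  covariance : ∀ i j, ∫ ω, X ω i * conj (X ω j) ∂P = C i j
  circular : ∀ i j, ∫ ω, X ω i * X ω j ∂P = 0

/-- The real and imaginary parts (second index `false` and `true` respectively) of the coordinates
of a complex vector. -/
noncomputable def reIm {ι : Type*} : (ι → ℂ) →ₗ[ℝ] (ι × Bool → ℝ) where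
  toFun z p := if p.2 then (z p.1).im else (z p.1).re
  map_add' z w := by ext p; simp only [Pi.add_apply]; split_ifs <;> simp
  map_smul' c z := by ext p; simp only [Pi.smul_apply]; split_ifs <;> simp

@[simp] lemma reIm_true {ι : Type*} (z : ι → ℂ) (i : ι) : reIm z (i, true) = (z i).im := rfl
@[simp] lemma reIm_false {ι : Type*} (z : ι → ℂ) (i : ι) : reIm z (i, false) = (z i).re := rfl

lemma sum_reIm_sq {ι : Type*} [Fintype ι] (a : ι → ℝ) (z : ι → ℂ) :
    ∑ p, a p.1 * reIm z p ^ 2 = ∑ i, a i * ‖z i‖ ^ 2 := by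
  rw [Fintype.sum_prod_type]
  refine Finset.sum_congr rfl fun i _ => ?_
  rw [Fintype.sum_bool, reIm_true, reIm_false, Complex.sq_norm, Complex.normSq_apply]
  ring

lemma measurable_ofReIm {ι : Type*} :
    Measurable fun (x : ι × Bool → ℝ) (i : ι) => (⟨x (i, false), x (i, true)⟩ : ℂ) :=
  measurable_pi_lambda _ fun i => Complex.measurableEquivRealProd.symm.measurable.comp
    (f := fun x : ι × Bool → ℝ => (x (i, false), x (i, true))) (by fun_prop)

namespace IsCircularGaussian

variable {Ω ι κ : Type*} [MeasurableSpace Ω] [Fintype ι] [Fintype κ] {X : Ω → ι → ℂ}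
  {Y : Ω → κ → ℂ} {C : Matrix ι ι ℂ} {D : Matrix κ κ ℂ} {P : Measure Ω}

lemma hasGaussianLaw_eval (hX : IsCircularGaussian X C P) (i : ι) :
    HasGaussianLaw (fun ω => X ω i) P :=
  HasGaussianLaw.eval (X := fun i ω => X ω i) hX.gaussian i

lemma memLp (hX : IsCircularGaussian X C P) (i : ι) : MemLp (fun ω => X ω i) 2 P :=
  (hX.hasGaussianLaw_eval i).memLp_two

lemma integrable (hX : IsCircularGaussian X C P) (i : ι) : Integrable (fun ω => X ω i) P :=
  (hX.hasGaussianLaw_eval i).integrable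

lemma integrable_mul_conj (hX : IsCircularGaussian X C P) (i j : ι) :
    Integrable (fun ω => X ω i * conj (X ω j)) P :=
  (hX.memLp i).integrable_mul (hX.memLp j).star

lemma integrable_mul (hX : IsCircularGaussian X C P) (i j : ι) :
    Integrable (fun ω => X ω i * X ω j) P :=
  (hX.memLp i).integrable_mul (hX.memLp j)

lemma integrable_norm_sq (hX : IsCircularGaussian X C P) (i : ι) :
    Integrable (fun ω => ‖X ω i‖ ^ 2) P :=
  (memLp_two_iff_integrable_sq_norm (hX.memLp i).1).1 (hX.memLp i)

/-- A linear image of a circular Gaussian vector is circular Gaussian. -/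
lemma mulVec (hX : IsCircularGaussian X C P) (A : Matrix κ ι ℂ) :
    IsCircularGaussian (fun ω => A *ᵥ X ω) (A * C * Aᴴ) P where
  gaussian := by
    have := hX.gaussian.map (LinearMap.toContinuousLinearMap
      ((Matrix.mulVecLin A).restrictScalars ℝ))
    exact this
  mean_zero i := by
    simp only [Matrix.mulVec, dotProduct]
    rw [integral_finsetSum _ fun j _ => (hX.integrable j).const_mul _]
    exact Finset.sum_eq_zero fun j _ => by rw [integral_const_mul, hX.mean_zero, mul_zero]
  covariance i j := by
    have h : ∀ ω, (A *ᵥ X ω) i * conj ((A *ᵥ X ω) j)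
        = ∑ l, ∑ k, A i k * conj (A j l) * (X ω k * conj (X ω l)) := by
      intro ω
      simp only [Matrix.mulVec, dotProduct, map_sum, map_mul, Finset.sum_mul_sum]
      rw [Finset.sum_comm]
      exact Finset.sum_congr rfl fun k _ => Finset.sum_congr rfl fun l _ => by ring
    simp_rw [h]
    rw [integral_finsetSum _ fun l _ => integrable_finsetSum _ fun k _ =>
      (hX.integrable_mul_conj k l).const_mul _]
    rw [Matrix.mul_apply]
    refine Finset.sum_congr rfl fun l _ => ?_
    rw [integral_finsetSum _ fun k _ => (hX.integrable_mul_conj k l).const_mul _, Matrix.mul_apply,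
      Finset.sum_mul]
    refine Finset.sum_congr rfl fun k _ => ?_
    rw [integral_const_mul, hX.covariance, Matrix.conjTranspose_apply, RCLike.star_def]
    ring
  circular i j := by
    have h : ∀ ω, (A *ᵥ X ω) i * (A *ᵥ X ω) j
        = ∑ l, ∑ k, A i k * A j l * (X ω k * X ω l) := by
      intro ω
      simp only [Matrix.mulVec, dotProduct, Finset.sum_mul_sum]
      rw [Finset.sum_comm]
      exact Finset.sum_congr rfl fun k _ => Finset.sum_congr rfl fun l _ => by ring
    simp_rw [h]
    rw [integral_finsetSum _ fun l _ => integrable_finsetSum _ fun k _ =>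
      (hX.integrable_mul k l).const_mul _]
    refine Finset.sum_eq_zero fun l _ => ?_
    rw [integral_finsetSum _ fun k _ => (hX.integrable_mul k l).const_mul _]
    exact Finset.sum_eq_zero fun k _ => by rw [integral_const_mul, hX.circular, mul_zero]

/-- Stacking two independent circular Gaussian vectors. -/
lemma sumElim (hX : IsCircularGaussian X C P) (hY : IsCircularGaussian Y D P)
    (hXY : IndepFun X Y P) :
    IsCircularGaussian (fun ω => Sum.elim (X ω) (Y ω)) (Matrix.fromBlocks C 0 0 D) P where
  gaussian := by
    let T : (ι → ℂ) × (κ → ℂ) →ₗ[ℝ] (ι ⊕ κ → ℂ) :=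
      { toFun := fun p => Sum.elim p.1 p.2
        map_add' := fun p q => by ext i; cases i <;> simp
        map_smul' := fun c p => by ext i; cases i <;> simp }
    exact (hXY.hasGaussianLaw hX.gaussian hY.gaussian).map (LinearMap.toContinuousLinearMap T)
  mean_zero i := by
    cases i
    · exact hX.mean_zero _
    · exact hY.mean_zero _
  covariance i j := by
    cases i with
    | inl i =>
      cases j with
      | inl j => exact hX.covariance i j
      | inr j =>
        have h : IndepFun (fun ω => X ω i) (fun ω => conj (Y ω j)) P :=
          hXY.comp (φ := fun x : ι → ℂ => x i) (ψ := fun y : κ → ℂ => conj (y j)) (by fun_prop)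
            (Complex.continuous_conj.measurable.comp (measurable_pi_apply j))
        simpa [hX.mean_zero i] using
          h.integral_fun_mul_eq_mul_integral (hX.memLp i).1 (hY.memLp j).star.1
    | inr i =>
      cases j with
      | inl j =>
        have h : IndepFun (fun ω => Y ω i) (fun ω => conj (X ω j)) P :=
          hXY.symm.comp (φ := fun x : κ → ℂ => x i) (ψ := fun y : ι → ℂ => conj (y j)) (by fun_prop)
            (Complex.continuous_conj.measurable.comp (measurable_pi_apply j))
        simpa [hY.mean_zero i] using
          h.integral_fun_mul_eq_mul_integral (hY.memLp i).1 (hX.memLp j).star.1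
      | inr j => exact hY.covariance i j
  circular i j := by
    cases i with
    | inl i =>
      cases j with
      | inl j => exact hX.circular i j
      | inr j =>
        have h : IndepFun (fun ω => X ω i) (fun ω => Y ω j) P :=
          hXY.comp (φ := fun x : ι → ℂ => x i) (ψ := fun y : κ → ℂ => y j) (by fun_prop) (by fun_prop)
        simpa [hX.mean_zero i] using
          h.integral_fun_mul_eq_mul_integral (hX.memLp i).1 (hY.memLp j).1
    | inr i =>
      cases j with
      | inl j =>
        have h : IndepFun (fun ω => Y ω i) (fun ω => X ω j) P :=
          hXY.symm.comp (φ := fun x : κ → ℂ => x i) (ψ := fun y : ι → ℂ => y j) (by fun_prop) (by fun_prop)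
        simpa [hY.mean_zero i] using
          h.integral_fun_mul_eq_mul_integral (hY.memLp i).1 (hX.memLp j).1
      | inr j => exact hY.circular i j

lemma integral_norm_sq (hX : IsCircularGaussian X C P) (i : ι) :
    ((∫ ω, ‖X ω i‖ ^ 2 ∂P : ℝ) : ℂ) = C i i := by
  rw [← hX.covariance i i, ← integral_complex_ofReal]
  congr 1
  ext ω
  rw [Complex.mul_conj, Complex.normSq_eq_norm_sq]

lemma integral_norm_sq_eq_re (hX : IsCircularGaussian X C P) (i : ι) :
    ∫ ω, ‖X ω i‖ ^ 2 ∂P = (C i i).re := by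
  rw [← hX.integral_norm_sq i, Complex.ofReal_re]

/-- Covariance matrices are positive semidefinite. -/
lemma posSemidef (hX : IsCircularGaussian X C P) : C.PosSemidef := by
  refine .of_dotProduct_mulVec_nonneg ?_ fun x => ?_
  · ext i j
    rw [Matrix.conjTranspose_apply, ← hX.covariance i j, ← hX.covariance j i, RCLike.star_def,
      ← integral_conj]
    congr 1
    ext ω
    simp [mul_comm]
  · have h := (hX.mulVec (Matrix.replicateRow Unit (star x))).integral_norm_sq ()
    have h2 : (Matrix.replicateRow Unit (star x) * C * (Matrix.replicateRow Unit (star x))ᴴ) () ()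
        = star x ⬝ᵥ C *ᵥ x := by
      simp [Matrix.mul_apply, Matrix.mulVec, dotProduct, Finset.mul_sum, Finset.sum_mul]
      rw [Finset.sum_comm]
      exact Finset.sum_congr rfl fun k _ => Finset.sum_congr rfl fun l _ => by ring
    rw [← h2, ← h]
    exact Complex.zero_le_real.2 (integral_nonneg fun ω => by positivity)

lemma hasGaussianLaw_reIm (hX : IsCircularGaussian X C P) :
    HasGaussianLaw (fun ω => reIm (X ω)) P :=
  hX.gaussian.map (LinearMap.toContinuousLinearMap reIm)

lemma memLp_reIm (hX : IsCircularGaussian X C P) (p : ι × Bool) :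
    MemLp (fun ω => reIm (X ω) p) 2 P :=
  (HasGaussianLaw.eval (X := fun p ω => reIm (X ω) p) hX.hasGaussianLaw_reIm p).memLp_two

lemma integral_reIm (hX : IsCircularGaussian X C P) (p : ι × Bool) :
    ∫ ω, reIm (X ω) p ∂P = 0 := by
  have hi := hX.integrable p.1
  obtain ⟨i, b⟩ := p
  cases b
  · have := integral_re (𝕜 := ℂ) hi
    simpa [hX.mean_zero i] using this
  · have := integral_im (𝕜 := ℂ) hi
    simpa [hX.mean_zero i] using this

/-- The covariances of the real and imaginary parts are determined by the complex covariances,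
because the pseudo-covariances vanish. -/
lemma cov_reIm (hX : IsCircularGaussian X C P) (i j : ι) (b b' : Bool) :
    cov[fun ω => reIm (X ω) (i, b), fun ω => reIm (X ω) (j, b'); P]
      = if b = b' then (C i j).re / 2 else if b then (C i j).im / 2 else -(C i j).im / 2 := by
  have hP := hX.gaussian.isProbabilityMeasure
  have h1 := hX.integrable_mul_conj i j
  have h2 := hX.integrable_mul i j
  have e1 := integral_re (𝕜 := ℂ) h1
  have e2 := integral_im (𝕜 := ℂ) h1
  have e3 := integral_re (𝕜 := ℂ) h2
  have e4 := integral_im (𝕜 := ℂ) h2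
  rw [hX.covariance] at e1 e2
  rw [hX.circular] at e3 e4
  simp only [RCLike.re_to_complex, RCLike.im_to_complex, Complex.zero_re, Complex.zero_im] at e1 e2 e3 e4
  have f1 : Integrable (fun ω => (X ω i * conj (X ω j)).re) P := h1.re
  have f2 : Integrable (fun ω => (X ω i * conj (X ω j)).im) P := h1.im
  have f3 : Integrable (fun ω => (X ω i * X ω j).re) P := h2.re
  have f4 : Integrable (fun ω => (X ω i * X ω j).im) P := h2.im
  rw [covariance_eq_sub (hX.memLp_reIm _) (hX.memLp_reIm _), hX.integral_reIm, zero_mul, sub_zero]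
  cases b <;> cases b'
  · have : ∀ ω, reIm (X ω) (i, false) * reIm (X ω) (j, false)
        = ((X ω i * conj (X ω j)).re + (X ω i * X ω j).re) / 2 := fun ω => by simp
    simp only [Pi.mul_apply, this]
    rw [integral_div, integral_add f1 f3, e1, e3]; simp
  · have : ∀ ω, reIm (X ω) (i, false) * reIm (X ω) (j, true)
        = (-(X ω i * conj (X ω j)).im + (X ω i * X ω j).im) / 2 := fun ω => by simp; ring
    simp only [Pi.mul_apply, this]
    have f2' : Integrable (fun ω => -(X ω i * conj (X ω j)).im) P := f2.neg
    rw [integral_div, integral_add f2' f4, integral_neg, e2, e4]; simp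
  · have : ∀ ω, reIm (X ω) (i, true) * reIm (X ω) (j, false)
        = ((X ω i * conj (X ω j)).im + (X ω i * X ω j).im) / 2 := fun ω => by simp; ring
    simp only [Pi.mul_apply, this]
    rw [integral_div, integral_add f2 f4, e2, e4]; simp
  · have : ∀ ω, reIm (X ω) (i, true) * reIm (X ω) (j, true)
        = ((X ω i * conj (X ω j)).re - (X ω i * X ω j).re) / 2 := fun ω => by simp
    simp only [Pi.mul_apply, this]
    rw [integral_div, integral_sub f1 f3, e1, e3]; simp

/-- Uncorrelated blocks of a circular Gaussian vector are independent. -/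
lemma indepFun_inl_inr {Z : Ω → ι ⊕ κ → ℂ} {E : Matrix (ι ⊕ κ) (ι ⊕ κ) ℂ}
    (hZ : IsCircularGaussian Z E P) (h : ∀ i j, E (Sum.inl i) (Sum.inr j) = 0) :
    IndepFun (fun ω i => Z ω (Sum.inl i)) (fun ω j => Z ω (Sum.inr j)) P := by
  let T : (ι ⊕ κ → ℂ) →ₗ[ℝ] (ι × Bool → ℝ) × (κ × Bool → ℝ) :=
    (reIm ∘ₗ LinearMap.funLeft ℝ ℂ Sum.inl).prod (reIm ∘ₗ LinearMap.funLeft ℝ ℂ Sum.inr)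
  have hT := hZ.gaussian.map (LinearMap.toContinuousLinearMap T)
  have hind := HasGaussianLaw.indepFun_of_covariance_eval
    (X := fun (p : ι × Bool) ω => reIm (fun i => Z ω (Sum.inl i)) p)
    (Y := fun (p : κ × Bool) ω => reIm (fun i => Z ω (Sum.inr i)) p) hT (by
      rintro ⟨i, b⟩ ⟨j, b'⟩
      have := hZ.cov_reIm (Sum.inl i) (Sum.inr j) b b'
      rw [h i j] at this
      simpa using! this)
  exact hind.comp measurable_ofReIm measurable_ofReIm

/-- The rescaled real and imaginary parts of a circular Gaussian vector with diagonal covariance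
matrix are independent standard normal variables. -/
lemma map_reIm_eq_stdNormal [DecidableEq ι] {v : ι → ℝ} (hv : ∀ i, 0 < v i)
    (hX : IsCircularGaussian X (Matrix.diagonal fun i => (v i : ℂ)) P) :
    P.map (fun ω p => √(2 / v p.1) * reIm (X ω) p) = stdNormal (ι × Bool) := by
  have hP := hX.gaussian.isProbabilityMeasure
  set W : ι × Bool → Ω → ℝ := fun p ω => √(2 / v p.1) * reIm (X ω) p with hW
  let T : (ι × Bool → ℝ) →ₗ[ℝ] (ι × Bool → ℝ) :=
    LinearMap.pi fun p => √(2 / v p.1) • LinearMap.proj p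
  have hG : HasGaussianLaw (fun ω p => W p ω) P :=
    hX.hasGaussianLaw_reIm.map (LinearMap.toContinuousLinearMap T)
  have hcov : ∀ p q, cov[W p, W q; P] = if p = q then 1 else 0 := by
    rintro ⟨i, b⟩ ⟨j, b'⟩
    simp only [hW]
    rw [covariance_const_mul_left, covariance_const_mul_right, hX.cov_reIm]
    by_cases hij : i = j
    · subst hij
      have := (hv i).ne'
      cases b <;> cases b' <;> simp [Matrix.diagonal_apply_eq]
      all_goals
        rw [← mul_assoc, ← Real.sqrt_mul_self (Real.sqrt_nonneg _), Real.sqrt_mul_self (Real.sqrt_nonneg _)]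
        field_simp
        rw [Real.sq_sqrt (hv i).le, Real.sq_sqrt zero_le_two]
        try field_simp
    · rw [Matrix.diagonal_apply_ne _ hij]
      simp [hij]
  have hind : iIndepFun W P := hG.iIndepFun_of_covariance_eq_zero fun p q hpq => by
    rw [hcov, if_neg hpq]
  have hae : ∀ p, AEMeasurable (W p) P := fun p => (hG.eval p).aemeasurable
  have := (iIndepFun_iff_map_fun_eq_pi_map hae).1 hind
  rw [show (fun ω p => √(2 / v p.1) * reIm (X ω) p) = fun ω p => W p ω from rfl, this]
  congr 1
  ext1 p
  rw [(hG.eval p).map_eq_gaussianReal, ← covariance_self (hae p), hcov, if_pos rfl]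
  congr 1
  · simp only [hW]
    rw [integral_const_mul, hX.integral_reIm, mul_zero]
  · simp

end IsCircularGaussian

/-! ### Covariance matrices -/

open scoped MatrixOrder in
/-- Two positive definite matrices are simultaneously diagonalized by a congruence. -/
lemma exists_simultaneous_diagonalization {n : Type*} [Fintype n] [DecidableEq n]
    {A B : Matrix n n ℂ} (hA : A.PosDef) (hB : B.PosDef) :
    ∃ (V : Matrix n n ℂ) (a : n → ℝ), (∀ i, 0 < a i) ∧ V * A * Vᴴ = 1 ∧
      V * B * Vᴴ = Matrix.diagonal (fun i => (((a i)⁻¹ : ℝ) : ℂ)) ∧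
      B⁻¹ = Vᴴ * Matrix.diagonal (fun i => (a i : ℂ)) * V := by
  -- `V = Uᴴ A^(-1/2)`, where the unitary `U` diagonalizes `A^(1/2) B⁻¹ A^(1/2)`
  set S := CFC.sqrt A with hS
  have hSS : S * S = A := CFC.sqrt_mul_sqrt_self A hA.posSemidef.nonneg
  have hSh : Sᴴ = S := (Matrix.nonneg_iff_posSemidef.1 (CFC.sqrt_nonneg A)).1
  have hAu := (Matrix.isUnit_iff_isUnit_det A).1 hA.isUnit
  have hSu : IsUnit S.det := by
    rw [← hSS, Matrix.det_mul] at hAu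
    exact isUnit_of_mul_isUnit_left hAu
  have hBu := (Matrix.isUnit_iff_isUnit_det B).1 hB.isUnit
  have hH : (S * B⁻¹ * S).PosDef := by
    have h := hB.inv.conjTranspose_mul_mul_same (B := S)
      (Matrix.mulVec_injective_iff_isUnit.2 ((Matrix.isUnit_iff_isUnit_det S).2 hSu))
    rwa [hSh] at h
  have hsp := hH.1.spectral_theorem
  rw [Unitary.conjStarAlgAut_apply] at hsp
  set U : Matrix n n ℂ := (hH.1.eigenvectorUnitary : Matrix n n ℂ) with hU
  have hU1 : Uᴴ * U = 1 := Unitary.coe_star_mul_self _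
  have hU2 : U * Uᴴ = 1 := Unitary.coe_mul_star_self _
  set a := hH.1.eigenvalues with ha
  have ha0 : ∀ i, 0 < a i := hH.eigenvalues_pos
  have hSi : (S⁻¹)ᴴ = S⁻¹ := by rw [Matrix.conjTranspose_nonsing_inv, hSh]
  have e1 : S * S⁻¹ = 1 := Matrix.mul_nonsing_inv S hSu
  have e2 : S⁻¹ * S = 1 := Matrix.nonsing_inv_mul S hSu
  have hVh : (Uᴴ * S⁻¹)ᴴ = S⁻¹ * U := by
    rw [Matrix.conjTranspose_mul, Matrix.conjTranspose_conjTranspose, hSi]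
  have hD : S * B⁻¹ * S = U * Matrix.diagonal (fun i => (a i : ℂ)) * Uᴴ := hsp
  have hBinv : B⁻¹ = S⁻¹ * U * Matrix.diagonal (fun i => (a i : ℂ)) * (Uᴴ * S⁻¹) := by
    calc B⁻¹ = (S⁻¹ * S) * B⁻¹ * (S * S⁻¹) := by rw [e1, e2, one_mul, mul_one]
      _ = S⁻¹ * (S * B⁻¹ * S) * S⁻¹ := by simp only [Matrix.mul_assoc]
      _ = _ := by rw [hD]; simp only [Matrix.mul_assoc]
  refine ⟨Uᴴ * S⁻¹, a, ha0, ?_, ?_, ?_⟩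
  · rw [hVh, ← hSS]
    calc Uᴴ * S⁻¹ * (S * S) * (S⁻¹ * U) = Uᴴ * (S⁻¹ * S) * (S * S⁻¹) * U := by
          simp only [Matrix.mul_assoc]
      _ = 1 := by rw [e1, e2, mul_one, mul_one, hU1]
  · have hdd : Matrix.diagonal (fun i => (((a i)⁻¹ : ℝ) : ℂ)) * Matrix.diagonal (fun i => (a i : ℂ))
        = 1 := by
      rw [Matrix.diagonal_mul_diagonal, ← Matrix.diagonal_one]
      congr 1; ext i
      have : (a i : ℂ) ≠ 0 := by exact_mod_cast (ha0 i).ne'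
      push_cast
      exact inv_mul_cancel₀ this
    have hdd' := mul_eq_one_comm.1 hdd
    have hB' : B = S * U * Matrix.diagonal (fun i => (((a i)⁻¹ : ℝ) : ℂ)) * (Uᴴ * S) := by
      have h1 : B⁻¹ * (S * U * Matrix.diagonal (fun i => (((a i)⁻¹ : ℝ) : ℂ)) * (Uᴴ * S)) = 1 := by
        rw [hBinv]
        calc _ = S⁻¹ * U * (Matrix.diagonal (fun i => (a i : ℂ)) * (Uᴴ * (S⁻¹ * S) * U *
              Matrix.diagonal (fun i => (((a i)⁻¹ : ℝ) : ℂ)))) * (Uᴴ * S) := by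
              simp only [Matrix.mul_assoc]
          _ = S⁻¹ * (U * Uᴴ) * S := by
              rw [e2, mul_one, hU1, one_mul, hdd', mul_one]; simp only [Matrix.mul_assoc]
          _ = 1 := by rw [hU2, mul_one, e2]
      rw [← Matrix.nonsing_inv_nonsing_inv B hBu]
      exact Matrix.inv_eq_right_inv h1
    rw [hVh, hB']
    calc _ = Uᴴ * (S⁻¹ * S) * U * Matrix.diagonal (fun i => (((a i)⁻¹ : ℝ) : ℂ)) *
          (Uᴴ * (S * S⁻¹) * U) := by simp only [Matrix.mul_assoc]
      _ = _ := by rw [e1, e2, mul_one, hU1, one_mul, mul_one]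
  · rw [hVh, hBinv]

lemma dotProduct_diagonal_mulVec {n : Type*} [Fintype n] [DecidableEq n] (V : Matrix n n ℂ)
    (a : n → ℝ) (y : n → ℂ) :
    (star y ⬝ᵥ ((Vᴴ * Matrix.diagonal (fun i => (a i : ℂ)) * V) *ᵥ y)).re
      = ∑ i, a i * ‖(V *ᵥ y) i‖ ^ 2 := by
  rw [← Matrix.mulVec_mulVec, ← Matrix.mulVec_mulVec, Matrix.dotProduct_mulVec,
    ← Matrix.star_mulVec, dotProduct, Complex.re_sum]
  refine Finset.sum_congr rfl fun i _ => ?_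
  rw [Matrix.mulVec_diagonal, Pi.star_apply, RCLike.star_def, mul_left_comm, Complex.conj_mul',
    ← Complex.ofReal_pow, ← Complex.ofReal_mul, Complex.ofReal_re]

section Bounds

variable {N : ℕ} {A B : Matrix (Fin N) (Fin N) ℂ} {σ : ℝ}

lemma posDef_of_sub_smul_one (hσ : 0 < σ) (hB : (B - (σ : ℂ) • 1).PosSemidef) : B.PosDef := by
  have : ((σ : ℂ) • (1 : Matrix (Fin N) (Fin N) ℂ)).PosDef :=
    Matrix.PosDef.one.smul (by exact_mod_cast hσ)
  simpa using Matrix.PosDef.posSemidef_add hB this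

/-- If `B ≥ σ I` and `A ≥ 0`, then `(A + B)⁻¹` has norm at most `1 / σ`, here applied to a
vector. -/
lemma norm_inv_mulVec_le (hσ : 0 < σ) (hA : A.PosSemidef) (hB : (B - (σ : ℂ) • 1).PosSemidef)
    (y : EuclideanSpace ℂ (Fin N)) :
    ‖(WithLp.toLp 2 ((A + B)⁻¹ *ᵥ y.ofLp) : EuclideanSpace ℂ (Fin N))‖ ≤ ‖y‖ / σ := by
  have hpd : (A + B).PosDef := Matrix.PosDef.posSemidef_add hA (posDef_of_sub_smul_one hσ hB)
  set u : EuclideanSpace ℂ (Fin N) := WithLp.toLp 2 ((A + B)⁻¹ *ᵥ y.ofLp) with hu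
  have hy : (A + B) *ᵥ u.ofLp = y.ofLp := by
    rw [hu, Matrix.mulVec_mulVec, Matrix.mul_nonsing_inv _ ((Matrix.isUnit_iff_isUnit_det _).1 hpd.isUnit),
      Matrix.one_mulVec]
  have h1 := (hA.add hB).re_dotProduct_nonneg u.ofLp
  have h2 : star u.ofLp ⬝ᵥ ((A + (B - (σ : ℂ) • 1)) *ᵥ u.ofLp)
      = inner ℂ u y - (σ : ℂ) * inner ℂ u u := by
    rw [← add_sub_assoc, Matrix.sub_mulVec, hy, Matrix.smul_mulVec, Matrix.one_mulVec,
      dotProduct_sub, dotProduct_smul, EuclideanSpace.inner_eq_star_dotProduct,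
      EuclideanSpace.inner_eq_star_dotProduct, dotProduct_comm, dotProduct_comm _ u.ofLp, smul_eq_mul]
  rw [h2, inner_self_eq_norm_sq_to_K] at h1
  have h3 : RCLike.re (inner ℂ u y) ≤ ‖u‖ * ‖y‖ := re_inner_le_norm u y
  have h4 : σ * ‖u‖ ^ 2 ≤ ‖u‖ * ‖y‖ := by
    have : RCLike.re ((σ : ℂ) * ((‖u‖ : ℂ)) ^ 2) = σ * ‖u‖ ^ 2 := by
      rw [← Complex.ofReal_pow, ← Complex.ofReal_mul]; exact Complex.ofReal_re _
    rw [map_sub] at h1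
    have h5 : 0 ≤ RCLike.re (inner ℂ u y) - σ * ‖u‖ ^ 2 := by rw [← this]; exact h1
    linarith
  rw [le_div_iff₀ hσ]
  rcases (norm_nonneg u).eq_or_lt with h0 | h0
  · rw [← h0, zero_mul]; exact norm_nonneg y
  · nlinarith

lemma re_dotProduct_inv_mulVec_le (hσ : 0 < σ) (hA : A.PosSemidef)
    (hB : (B - (σ : ℂ) • 1).PosSemidef) (y : EuclideanSpace ℂ (Fin N)) :
    (star y.ofLp ⬝ᵥ ((A + B)⁻¹ *ᵥ y.ofLp)).re ≤ ‖y‖ ^ 2 / σ := by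
  have h := re_inner_le_norm (𝕜 := ℂ) y (WithLp.toLp 2 ((A + B)⁻¹ *ᵥ y.ofLp))
  rw [EuclideanSpace.inner_eq_star_dotProduct, dotProduct_comm] at h
  refine (h.trans (mul_le_mul_of_nonneg_left (norm_inv_mulVec_le hσ hA hB y) (norm_nonneg y))).trans_eq ?_
  ring

/-- The entries of a positive semidefinite matrix with unit diagonal are at most `1` in modulus. -/
lemma norm_apply_le_one (hA : A.PosSemidef) (h1 : ∀ i, A i i = 1) (i j : Fin N) : ‖A i j‖ ≤ 1 := by
  have h := (hA.submatrix ![i, j]).det_nonneg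
  have hji : A j i = conj (A i j) := (hA.1.apply j i).symm
  rw [Matrix.det_fin_two] at h
  simp only [Matrix.submatrix_apply, Matrix.cons_val_zero, Matrix.cons_val_one, h1, mul_one] at h
  rw [hji, Complex.mul_conj'] at h
  have h2 : ‖A i j‖ ^ 2 ≤ 1 := by
    have h3 : (0 : ℝ) ≤ 1 - ‖A i j‖ ^ 2 := by exact_mod_cast h
    linarith
  nlinarith [norm_nonneg (A i j)]

lemma norm_mulVec_le (hA1 : ∀ i j, ‖A i j‖ ≤ 1) (u : EuclideanSpace ℂ (Fin N)) :
    ‖(WithLp.toLp 2 (A *ᵥ u.ofLp) : EuclideanSpace ℂ (Fin N))‖ ≤ N * ‖u‖ := by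
  refine (sq_le_sq₀ (norm_nonneg _) (by positivity)).1 ?_
  rw [EuclideanSpace.norm_sq_eq, mul_pow, EuclideanSpace.norm_sq_eq]
  have hrow : ∀ i, ‖(A *ᵥ u.ofLp) i‖ ^ 2 ≤ N * ∑ j, ‖u j‖ ^ 2 := by
    intro i
    have h1 : ‖(A *ᵥ u.ofLp) i‖ ≤ ∑ j, ‖u j‖ := by
      change ‖∑ j, A i j * u j‖ ≤ _
      refine (norm_sum_le _ _).trans (Finset.sum_le_sum fun j _ => ?_)
      rw [norm_mul]
      exact mul_le_of_le_one_left (norm_nonneg _) (hA1 i j)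
    have h2 := sq_sum_le_card_mul_sum_sq (s := Finset.univ) (f := fun j => ‖u j‖)
    rw [Finset.card_univ, Fintype.card_fin] at h2
    exact (pow_le_pow_left₀ (norm_nonneg _) h1 2).trans h2
  calc _ ≤ ∑ i : Fin N, N * ∑ j, ‖u j‖ ^ 2 := Finset.sum_le_sum fun i _ => hrow i
    _ = _ := by rw [Finset.sum_const, Finset.card_univ, Fintype.card_fin, nsmul_eq_mul]; ring

/-- The error covariance of any linear estimator `F` of a unit-variance signal observed in noise
with white component has trace bounded below: a small `F` leaves most of the signal unestimated, and
a large `F` lets the white noise through. -/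
lemma re_trace_error_ge (hN : 0 < N) (hσ : 0 < σ) (hA : A.PosSemidef) (h1 : ∀ i, A i i = 1)
    (hB : (B - (σ : ℂ) • 1).PosSemidef) (F : Matrix (Fin N) (Fin N) ℂ) :
    min 1 σ / 4 ≤ ((F - 1) * A * (F - 1)ᴴ + F * B * Fᴴ).trace.re := by
  set f : ℝ := (F * Fᴴ).trace.re with hf
  have hre : ∀ {C : Matrix (Fin N) (Fin N) ℂ}, C.PosSemidef → 0 ≤ C.trace.re := fun h =>
    (Complex.le_def.1 h.trace_nonneg).1
  have hf0 : 0 ≤ f := hre (Matrix.posSemidef_self_mul_conjTranspose F)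
  have e1 : σ * f ≤ (F * B * Fᴴ).trace.re := by
    have h := hre (hB.mul_mul_conjTranspose_same F)
    rw [Matrix.mul_sub, Matrix.sub_mul, Matrix.trace_sub, Matrix.mul_smul, Matrix.smul_mul, mul_one,
      Matrix.trace_smul, smul_eq_mul, Complex.sub_re, Complex.re_ofReal_mul] at h
    linarith
  have e2 : 0 ≤ ((F - 1) * A * (F - 1)ᴴ).trace.re := hre (hA.mul_mul_conjTranspose_same _)
  have e3 : (N : ℝ) ≤ 2 * ((F - 1) * A * (F - 1)ᴴ).trace.re + 2 * (F * A * Fᴴ).trace.re := by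
    -- the parallelogram law for `F - 1` and `F` in the seminorm defined by `A`
    have h := hre (hA.mul_mul_conjTranspose_same ((2 : ℂ) • F - 1))
    have hid : ((2 : ℂ) • F - 1) * A * ((2 : ℂ) • F - 1)ᴴ
        = (2 : ℂ) • ((F - 1) * A * (F - 1)ᴴ) + (2 : ℂ) • (F * A * Fᴴ) - A := by
      simp only [Matrix.conjTranspose_sub, Matrix.conjTranspose_smul, Matrix.conjTranspose_one,
        Matrix.sub_mul, Matrix.mul_sub, Matrix.smul_mul, Matrix.mul_smul, one_mul, mul_one,
        star_ofNat]
      module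
    have htr : A.trace = N := by simp [Matrix.trace, h1]
    rw [hid, Matrix.trace_sub, Matrix.trace_add, Matrix.trace_smul, Matrix.trace_smul, htr] at h
    simp only [Complex.sub_re, Complex.add_re, smul_eq_mul, Complex.mul_re, Complex.re_ofNat,
      Complex.im_ofNat, zero_mul, sub_zero, Complex.natCast_re] at h
    linarith
  have e4 : (F * A * Fᴴ).trace.re ≤ N * f := by
    have hA1 := norm_apply_le_one hA h1
    rw [hf, Matrix.trace, Matrix.trace, Complex.re_sum, Complex.re_sum, Finset.mul_sum]
    refine Finset.sum_le_sum fun i _ => ?_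
    set r : EuclideanSpace ℂ (Fin N) := WithLp.toLp 2 (star (F i)) with hr
    have h2 : (F * A * Fᴴ) i i = inner ℂ r (WithLp.toLp 2 (A *ᵥ r.ofLp)) := by
      rw [Matrix.mul_mul_apply, EuclideanSpace.inner_eq_star_dotProduct, dotProduct_comm]
      simp only [hr, star_star]
      rfl
    have h3 : ((F * Fᴴ) i i).re = ‖r‖ ^ 2 := by
      have : (F * Fᴴ) i i = inner ℂ r r := by
        rw [Matrix.mul_apply, EuclideanSpace.inner_eq_star_dotProduct, dotProduct_comm]
        simp only [hr, star_star]
        rfl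
      rw [this, inner_self_eq_norm_sq_to_K]
      exact_mod_cast Complex.ofReal_re _
    rw [Matrix.diag_apply, Matrix.diag_apply, h2, h3]
    refine (re_inner_le_norm (𝕜 := ℂ) _ _).trans ?_
    refine (mul_le_mul_of_nonneg_left (norm_mulVec_le hA1 r) (norm_nonneg r)).trans_eq ?_
    ring
  have hN1 : (1 : ℝ) ≤ N := by exact_mod_cast hN
  rw [Matrix.trace_add, Complex.add_re]
  by_cases hfs : f ≤ 1 / 4
  · have := min_le_left 1 σ
    nlinarith [mul_nonneg hσ.le hf0]
  · have := min_le_right 1 σ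
    nlinarith

end Bounds

/-! ### Moments of the norm of a circular Gaussian vector -/

namespace IsCircularGaussian

variable {Ω ι κ : Type*} [MeasurableSpace Ω] [Fintype ι] [Fintype κ] {X : Ω → ι → ℂ}
  {C : Matrix ι ι ℂ} {P : Measure Ω}

/-- A subvector of a circular Gaussian vector is circular Gaussian. -/
lemma submatrix (hX : IsCircularGaussian X C P) (f : κ → ι) :
    IsCircularGaussian (fun ω k => X ω (f k)) (C.submatrix f f) P where
  gaussian := hX.gaussian.map (LinearMap.toContinuousLinearMap (LinearMap.funLeft ℝ ℂ f))
  mean_zero k := hX.mean_zero (f k)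
  covariance k l := hX.covariance (f k) (f l)
  circular k l := hX.circular (f k) (f l)

lemma memLp_toLp (hX : IsCircularGaussian X C P) {p : ENNReal} (hp : p ≠ ⊤) :
    MemLp (fun ω => (WithLp.toLp 2 (X ω) : EuclideanSpace ℂ ι)) p P :=
  (HasGaussianLaw.toLp_pi 2 (X := fun i ω => X ω i) hX.gaussian).memLp hp

lemma integral_toLp_norm_sq (hX : IsCircularGaussian X C P) :
    ∫ ω, ‖(WithLp.toLp 2 (X ω) : EuclideanSpace ℂ ι)‖ ^ 2 ∂P = C.trace.re := by
  simp_rw [EuclideanSpace.norm_sq_eq]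
  rw [integral_finsetSum _ fun i _ => hX.integrable_norm_sq i, Matrix.trace, Complex.re_sum]
  exact Finset.sum_congr rfl fun i _ => hX.integral_norm_sq_eq_re i

lemma integral_toLp (hX : IsCircularGaussian X C P) :
    ∫ ω, (WithLp.toLp 2 (X ω) : EuclideanSpace ℂ ι) ∂P = 0 := by
  have hi := memLp_one_iff_integrable.1 (hX.memLp_toLp (p := 1) (by simp))
  ext i
  have h := (EuclideanSpace.proj (𝕜 := ℂ) i).integral_comp_comm hi
  change (EuclideanSpace.proj (𝕜 := ℂ) i) (∫ ω, WithLp.toLp 2 (X ω) ∂P) = 0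
  rw [← h]
  simpa using hX.mean_zero i

lemma integral_reIm_pow_four (hX : IsCircularGaussian X C P) (p : ι × Bool) :
    ∫ ω, reIm (X ω) p ^ 4 ∂P = ((C p.1 p.1).re / 2) ^ 2 * ∫ x, x ^ 4 ∂gaussianReal 0 1 := by
  have hG := HasGaussianLaw.eval (X := fun p ω => reIm (X ω) p) hX.hasGaussianLaw_reIm p
  have hvar : Var[fun ω => reIm (X ω) p; P] = (C p.1 p.1).re / 2 := by
    obtain ⟨i, b⟩ := p
    rw [← covariance_self hG.aemeasurable, hX.cov_reIm, if_pos rfl]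
  have hv0 : 0 ≤ (C p.1 p.1).re / 2 := hvar ▸ variance_nonneg _ _
  have hmap := hG.map_eq_gaussianReal
  have hscale := gaussianReal_map_const_mul (μ := 0) (v := 1) (√((C p.1 p.1).re / 2))
  rw [hX.integral_reIm, hvar] at hmap
  have heq : gaussianReal 0 ((C p.1 p.1).re / 2).toNNReal
      = (gaussianReal 0 1).map (√((C p.1 p.1).re / 2) * ·) := by
    rw [hscale, mul_zero, mul_one]
    congr 1
    ext
    rw [Real.coe_toNNReal _ hv0]
    exact (Real.sq_sqrt hv0).symm
  calc ∫ ω, reIm (X ω) p ^ 4 ∂P = ∫ x, x ^ 4 ∂P.map (fun ω => reIm (X ω) p) :=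
        (integral_map (f := fun x : ℝ => x ^ 4) hG.aemeasurable (by fun_prop)).symm
    _ = ∫ x, (√((C p.1 p.1).re / 2) * x) ^ 4 ∂gaussianReal 0 1 := by
        rw [hmap, heq, integral_map (by fun_prop) (by fun_prop)]
    _ = _ := by
        simp_rw [mul_pow]
        rw [integral_const_mul, show (4 : ℕ) = 2 * 2 from rfl, pow_mul, Real.sq_sqrt hv0]

lemma integral_toLp_norm_pow_four_le (hX : IsCircularGaussian X C P) {V : ℝ}
    (hV : ∀ i, (C i i).re ≤ V) :
    ∫ ω, ‖(WithLp.toLp 2 (X ω) : EuclideanSpace ℂ ι)‖ ^ 4 ∂P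
      ≤ (∫ x, x ^ 4 ∂gaussianReal 0 1) * V ^ 2 * Fintype.card ι ^ 2 := by
  have hle : ∀ ω, ‖(WithLp.toLp 2 (X ω) : EuclideanSpace ℂ ι)‖ ^ 4
      ≤ (2 * Fintype.card ι) * ∑ p, reIm (X ω) p ^ 4 := by
    intro ω
    have h1 : ‖(WithLp.toLp 2 (X ω) : EuclideanSpace ℂ ι)‖ ^ 2 = ∑ p, reIm (X ω) p ^ 2 := by
      rw [EuclideanSpace.norm_sq_eq]
      simpa using (sum_reIm_sq (fun _ => 1) (X ω)).symm
    have h2 := sq_sum_le_card_mul_sum_sq (s := Finset.univ) (f := fun p => reIm (X ω) p ^ 2)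
    rw [← h1, Finset.card_univ, Fintype.card_prod, Fintype.card_bool] at h2
    simp only [← pow_mul] at h2
    push_cast at h2
    rw [mul_comm (2 : ℝ)]
    exact h2
  have h4 : ∀ p : ι × Bool, Integrable (fun ω => reIm (X ω) p ^ 4) P := by
    intro p
    have hG := HasGaussianLaw.eval (X := fun p ω => reIm (X ω) p) hX.hasGaussianLaw_reIm p
    have hP := hX.gaussian.isProbabilityMeasure
    refine ((hG.memLp (p := 4) (by simp)).integrable_norm_pow (p := 4) (by norm_num)).congr ?_
    exact ae_of_all _ fun ω => by
      change |reIm (X ω) p| ^ 4 = _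
      rw [Even.pow_abs ⟨2, rfl⟩]
  have hv0 : ∀ i, 0 ≤ (C i i).re := fun i => by
    rw [← hX.integral_norm_sq_eq_re i]
    exact integral_nonneg fun ω => by positivity
  calc _ ≤ ∫ ω, (2 * Fintype.card ι) * ∑ p, reIm (X ω) p ^ 4 ∂P :=
        integral_mono_of_nonneg (ae_of_all _ fun ω => by positivity)
          ((integrable_finsetSum _ fun p _ => h4 p).const_mul _) (ae_of_all _ hle)
    _ = (2 * Fintype.card ι) * ∑ p : ι × Bool,
          ((C p.1 p.1).re / 2) ^ 2 * ∫ x, x ^ 4 ∂gaussianReal 0 1 := by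
        rw [integral_const_mul, integral_finsetSum _ fun p _ => h4 p]
        simp_rw [hX.integral_reIm_pow_four]
    _ ≤ (2 * Fintype.card ι) * ∑ p : ι × Bool, (V / 2) ^ 2 * ∫ x, x ^ 4 ∂gaussianReal 0 1 := by
        have h0 : 0 ≤ ∫ x, x ^ 4 ∂gaussianReal 0 1 := integral_nonneg fun x => by positivity
        gcongr with p
        · exact div_nonneg (hv0 p.1) zero_le_two
        · exact hV p.1
    _ = _ := by
        rw [Finset.sum_const, Finset.card_univ, Fintype.card_prod, Fintype.card_bool, nsmul_eq_mul]
        push_cast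
        ring

end IsCircularGaussian

/-! ### Pythagorean identities for mean-square errors -/

section Pythagoras

variable {Ω E : Type*} {m mΩ : MeasurableSpace Ω} {P : Measure Ω} [NormedAddCommGroup E]
  [InnerProductSpace ℝ E]

lemma integrable_inner_of_memLp {h e : Ω → E} (hh : MemLp h 2 P) (he : MemLp e 2 P) :
    Integrable (fun ω => inner ℝ (h ω) (e ω)) P :=
  (hh.norm.integrable_mul he.norm).mono' (hh.1.inner he.1)
    (ae_of_all _ fun _ => norm_inner_le_norm _ _)

lemma integral_norm_add_sq_of_integral_inner_eq_zero {h e : Ω → E} (hh : MemLp h 2 P)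
    (he : MemLp e 2 P) (h0 : ∫ ω, inner ℝ (h ω) (e ω) ∂P = 0) :
    ∫ ω, ‖h ω + e ω‖ ^ 2 ∂P = ∫ ω, ‖h ω‖ ^ 2 ∂P + ∫ ω, ‖e ω‖ ^ 2 ∂P := by
  have i1 : Integrable (fun ω => ‖h ω‖ ^ 2) P := (memLp_two_iff_integrable_sq_norm hh.1).1 hh
  have i2 : Integrable (fun ω => ‖e ω‖ ^ 2) P := (memLp_two_iff_integrable_sq_norm he.1).1 he
  have i3 : Integrable (fun ω => 2 * inner ℝ (h ω) (e ω)) P :=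
    (integrable_inner_of_memLp hh he).const_mul 2
  have i4 : Integrable (fun ω => ‖h ω‖ ^ 2 + 2 * inner ℝ (h ω) (e ω)) P := i1.add i3
  simp_rw [norm_add_sq_real]
  rw [integral_add i4 i2, integral_add i1 i3, integral_const_mul, h0, mul_zero, add_zero]

/-- The conditional expectation is the best mean-square predictor. -/
lemma integral_norm_condExp_sub_sq_le [CompleteSpace E] [IsFiniteMeasure P] (hm : m ≤ mΩ)
    {f h : Ω → E} (hf : MemLp f 2 P) (hh : MemLp h 2 P) (hhm : StronglyMeasurable[m] h) :
    ∫ ω, ‖(P[f | m]) ω - f ω‖ ^ 2 ∂P ≤ ∫ ω, ‖h ω - f ω‖ ^ 2 ∂P := by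
  set c := P[f | m] with hc
  have hcL : MemLp c 2 P := hf.condExp (by norm_num)
  have hd : MemLp (fun ω => h ω - c ω) 2 P := hh.sub hcL
  have hdm : StronglyMeasurable[m] (fun ω => h ω - c ω) := hhm.sub stronglyMeasurable_condExp
  have hr : MemLp (fun ω => c ω - f ω) 2 P := hcL.sub hf
  have i1 : Integrable (fun ω => inner ℝ (h ω - c ω) (f ω)) P := integrable_inner_of_memLp hd hf
  have i2 : Integrable (fun ω => inner ℝ (h ω - c ω) (c ω)) P := integrable_inner_of_memLp hd hcL
  have horth : ∫ ω, inner ℝ (h ω - c ω) (c ω - f ω) ∂P = 0 := by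
    have hpull := condExp_bilin_of_stronglyMeasurable_left (innerSL ℝ) hdm i1
      (hf.integrable (by norm_num))
    have h1 : ∫ ω, inner ℝ (h ω - c ω) (f ω) ∂P = ∫ ω, inner ℝ (h ω - c ω) (c ω) ∂P :=
      (integral_condExp hm).symm.trans (integral_congr_ae hpull)
    simp_rw [inner_sub_right]
    rw [integral_sub i2 i1, h1, sub_self]
  have hpyth := integral_norm_add_sq_of_integral_inner_eq_zero hd hr horth
  simp only [sub_add_sub_cancel] at hpyth
  rw [hpyth]
  exact le_add_of_nonneg_left (integral_nonneg fun ω => by positivity)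

end Pythagoras

section Linear

variable {Ω : Type*} [MeasurableSpace Ω] {P : Measure Ω} {N : ℕ} {A B : Matrix (Fin N) (Fin N) ℂ}
  {S W : Ω → Fin N → ℂ}

/-- The error of the linear MMSE estimator of `S` from `S + W` and the observation `S + W` itself
are jointly circular Gaussian and uncorrelated. -/
lemma isCircularGaussian_error_observation (hS : IsCircularGaussian S A P)
    (hW : IsCircularGaussian W B P) (hSW : IndepFun S W P) (hAB : (A + B).PosDef) :
    IsCircularGaussian
      (fun ω => Sum.elim ((A * (A + B)⁻¹) *ᵥ (S ω + W ω) - S ω) (S ω + W ω))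
      (Matrix.fromBlocks
        ((A * (A + B)⁻¹ - 1) * A * (A * (A + B)⁻¹ - 1)ᴴ +
          A * (A + B)⁻¹ * B * (A * (A + B)⁻¹)ᴴ) 0 0 (A + B)) P := by
  set F := A * (A + B)⁻¹ with hF
  have hFAB : F * (A + B) = A := by
    rw [hF, Matrix.mul_assoc, Matrix.nonsing_inv_mul _ ((Matrix.isUnit_iff_isUnit_det _).1 hAB.isUnit),
      mul_one]
  have hAh : Aᴴ = A := hS.posSemidef.1
  have hBh : Bᴴ = B := hW.posSemidef.1
  have hoff : (F - 1) * A + F * B = 0 := by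
    rw [Matrix.sub_mul, one_mul, sub_add_eq_add_sub, ← Matrix.mul_add, hFAB, sub_self]
  have hoff' : A * (F - 1)ᴴ + B * Fᴴ = 0 := by
    have := congrArg Matrix.conjTranspose hoff
    simpa [Matrix.conjTranspose_add, Matrix.conjTranspose_mul, hAh, hBh] using this
  have h := (hS.sumElim hW hSW).mulVec
    (Matrix.fromBlocks (F - 1) F (1 : Matrix (Fin N) (Fin N) ℂ) 1)
  have hvec : ∀ ω, Matrix.fromBlocks (F - 1) F (1 : Matrix (Fin N) (Fin N) ℂ) 1 *ᵥ Sum.elim (S ω) (W ω)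
      = Sum.elim (F *ᵥ (S ω + W ω) - S ω) (S ω + W ω) := by
    intro ω
    rw [Matrix.fromBlocks_mulVec]
    simp only [Sum.elim_comp_inl, Sum.elim_comp_inr, Matrix.one_mulVec, Matrix.sub_mulVec,
      Matrix.mulVec_add]
    congr 1
    abel
  have hcov : Matrix.fromBlocks (F - 1) F 1 1 * Matrix.fromBlocks A 0 0 B *
      (Matrix.fromBlocks (F - 1) F (1 : Matrix (Fin N) (Fin N) ℂ) 1)ᴴ
      = Matrix.fromBlocks ((F - 1) * A * (F - 1)ᴴ + F * B * Fᴴ) 0 0 (A + B) := by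
    rw [Matrix.fromBlocks_conjTranspose, Matrix.fromBlocks_multiply, Matrix.fromBlocks_multiply]
    simp only [Matrix.mul_zero, add_zero, zero_add, one_mul, Matrix.conjTranspose_one, mul_one,
      hoff, hoff']
  simp_rw [hvec] at h
  rwa [hcov] at h

/-- For a known type, the mean-square error of any estimator exceeds the one of the linear MMSE
estimator by the mean-square distance between the two, because the error of the latter is
independent of the observation. -/
lemma integral_norm_sub_sq_eq (hS : IsCircularGaussian S A P) (hW : IsCircularGaussian W B P)
    (hSW : IndepFun S W P) (hAB : (A + B).PosDef)
    {g : EuclideanSpace ℂ (Fin N) → EuclideanSpace ℂ (Fin N)} (hg : Measurable g)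
    (hgL : MemLp (fun ω => g (WithLp.toLp 2 (S ω + W ω))) 2 P) :
    ∫ ω, ‖g (WithLp.toLp 2 (S ω + W ω)) - WithLp.toLp 2 (S ω)‖ ^ 2 ∂P
      = ∫ ω, ‖g (WithLp.toLp 2 (S ω + W ω)) -
          WithLp.toLp 2 ((A * (A + B)⁻¹) *ᵥ (S ω + W ω))‖ ^ 2 ∂P
        + ((A * (A + B)⁻¹ - 1) * A * (A * (A + B)⁻¹ - 1)ᴴ +
          A * (A + B)⁻¹ * B * (A * (A + B)⁻¹)ᴴ).trace.re := by
  have hZ := isCircularGaussian_error_observation hS hW hSW hAB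
  set F := A * (A + B)⁻¹ with hF
  have hE : IsCircularGaussian (fun ω => F *ᵥ (S ω + W ω) - S ω)
    ((F - 1) * A * (F - 1)ᴴ + F * B * Fᴴ) P := hZ.submatrix Sum.inl
  have hY : IsCircularGaussian (fun ω => S ω + W ω) (A + B) P := hZ.submatrix Sum.inr
  have hP := hE.gaussian.isProbabilityMeasure
  have hind : IndepFun (fun ω => F *ᵥ (S ω + W ω) - S ω) (fun ω => S ω + W ω) P :=
    hZ.indepFun_inl_inr fun i j => rfl
  set T : (Fin N → ℂ) → EuclideanSpace ℂ (Fin N) := fun y =>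
    g (WithLp.toLp 2 y) - WithLp.toLp 2 (F *ᵥ y) with hT
  have hmul : Measurable fun y : Fin N → ℂ => F *ᵥ y :=
    (LinearMap.continuous_of_finiteDimensional (Matrix.mulVecLin F)).measurable
  have hTm : Measurable T :=
    (hg.comp (WithLp.measurable_toLp 2 _)).sub ((WithLp.measurable_toLp 2 _).comp hmul)
  have hTL : MemLp (fun ω => T (S ω + W ω)) 2 P :=
    hgL.sub ((hY.mulVec F).memLp_toLp (by simp))
  have hind' : IndepFun (fun ω => T (S ω + W ω))
      (fun ω => (WithLp.toLp 2 (F *ᵥ (S ω + W ω) - S ω) : EuclideanSpace ℂ (Fin N))) P :=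
    hind.symm.comp hTm (WithLp.measurable_toLp 2 _)
  have horth := hind'.integral_bilin (hTL.integrable (by norm_num))
    ((hE.memLp_toLp (p := 1) (by simp)).integrable le_rfl) (innerSL ℝ)
  rw [hE.integral_toLp, map_zero] at horth
  have hpyth := integral_norm_add_sq_of_integral_inner_eq_zero hTL
    (hE.memLp_toLp (p := 2) (by simp)) horth
  rw [hE.integral_toLp_norm_sq] at hpyth
  rw [← hpyth]
  refine integral_congr_ae (ae_of_all _ fun ω => ?_)
  simp only [hT, WithLp.toLp_sub, sub_add_sub_cancel]

end Linear

/-! ### Conditioning on the type -/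

section Conditioning

variable {Ω : Type*} [MeasurableSpace Ω] {μ : Measure Ω} {K : ℕ}
  {k : Ω → Fin K}

/-- The law of total expectation. A type of probability zero contributes `0`, since its weight
vanishes. -/
lemma integral_eq_sum_cond [IsProbabilityMeasure μ] (hk : Measurable k) {f : Ω → ℝ} (hf : Integrable f μ) :
    ∫ ω, f ω ∂μ = ∑ j, μ.real (k ⁻¹' {j}) * ∫ ω, f ω ∂μ[|k ⁻¹' {j}] := by
  rw [← sum_meas_smul_cond_fiber hk μ] at hf
  conv_lhs => rw [← sum_meas_smul_cond_fiber hk μ]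
  rw [integral_finsetSum_measure fun j hj => integrable_finsetSum_measure.1 hf j hj]
  exact Finset.sum_congr rfl fun j _ => by rw [integral_smul_measure]; rfl

lemma memLp_two_of_cond [IsProbabilityMeasure μ] {E : Type*} [NormedAddCommGroup E] (hk : Measurable k) {f : Ω → E}
    (hfm : AEStronglyMeasurable f μ)
    (hf : ∀ j, μ (k ⁻¹' {j}) ≠ 0 → MemLp f 2 μ[|k ⁻¹' {j}]) : MemLp f 2 μ := by
  rw [memLp_two_iff_integrable_sq_norm hfm, ← sum_meas_smul_cond_fiber hk μ,
    integrable_finsetSum_measure]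
  intro j _
  by_cases hj : μ (k ⁻¹' {j}) = 0
  · rw [hj, zero_smul]
    exact integrable_zero_measure
  · exact ((memLp_two_iff_integrable_sq_norm (hf j hj).1).1 (hf j hj)).smul_measure
      (measure_ne_top _ _)

lemma memLp_cond {E : Type*} [NormedAddCommGroup E] {f : Ω → E} {p : ENNReal} (hf : MemLp f p μ)
    {A : Set Ω} (hA : μ A ≠ 0) : MemLp f p μ[|A] :=
  hf.restrict A |>.smul_measure (ENNReal.inv_ne_top.2 hA)

lemma measureReal_inter_le_cond [IsProbabilityMeasure μ] {A : Set Ω} (hA : MeasurableSet A) (E : Set Ω) :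
    μ.real (A ∩ E) ≤ (μ[|A]).real E := by
  rw [measureReal_def, measureReal_def, ← cond_mul_eq_inter hA, ENNReal.toReal_mul]
  exact mul_le_of_le_one_right ENNReal.toReal_nonneg measureReal_le_one

end Conditioning

/-! ### The signal model -/

section Model

variable {Ω : Type*} [MeasurableSpace Ω] {μ : Measure Ω}
  {K : ℕ} {k : Ω → Fin K} {s b : ℕ → Ω → ℂ} {Cs : Matrix ℕ ℕ ℂ} {Cb : Fin K → Matrix ℕ ℕ ℂ}

lemma IsCircularGaussianProcess.isCircularGaussian {P : Measure Ω} {X : ℕ → Ω → ℂ}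
    {C : Matrix ℕ ℕ ℂ} (hX : IsCircularGaussianProcess X C P) (N : ℕ) :
    IsCircularGaussian (fun ω (i : Fin N) => X i ω) (block C N) P where
  gaussian := by
    let T : (Finset.range N → ℂ) →ₗ[ℝ] (Fin N → ℂ) :=
      LinearMap.funLeft ℝ ℂ fun i : Fin N => ⟨i, Finset.mem_range.2 i.2⟩
    exact (hX.gaussian.hasGaussianLaw (Finset.range N)).map (LinearMap.toContinuousLinearMap T)
  mean_zero i := hX.mean_zero i
  covariance i j := hX.covariance i j
  circular i j := hX.circular i j

lemma measurable_batch {X : ℕ → Ω → ℂ} (hX : ∀ n, Measurable (X n)) (N : ℕ) :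
    Measurable (batch X N) :=
  (WithLp.measurable_toLp 2 _).comp (measurable_pi_lambda _ fun i => hX i)

lemma measurable_mixture (hmodel : GaussianMixtureModel μ k s b Cs Cb) (n : ℕ) :
    Measurable (mixture s b n) :=
  (hmodel.measurable_soi n).add (hmodel.measurable_interference n)

lemma measurable_lmmse (Cs Cj : Matrix ℕ ℕ ℂ) (N : ℕ) : Measurable (lmmse Cs Cj N) := by
  have h : Measurable fun y : Fin N → ℂ => (block Cs N * (mixtureCov Cs Cj N)⁻¹) *ᵥ y :=
    (LinearMap.continuous_of_finiteDimensional
      (Matrix.mulVecLin (block Cs N * (mixtureCov Cs Cj N)⁻¹))).measurable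
  exact (WithLp.measurable_toLp 2 _).comp (h.comp (WithLp.measurable_ofLp 2 _))

namespace GaussianMixtureModel

lemma exists_pos [IsProbabilityMeasure μ] (hmodel : GaussianMixtureModel μ k s b Cs Cb) : ∃ j, μ (k ⁻¹' {j}) ≠ 0 := by
  by_contra! h
  have := sum_meas_smul_cond_fiber hmodel.measurable_type μ
  simp only [h, zero_smul, Finset.sum_const_zero] at this
  exact IsProbabilityMeasure.ne_zero μ this.symm

lemma soi (hmodel : GaussianMixtureModel μ k s b Cs Cb) {j : Fin K} (hj : μ (k ⁻¹' {j}) ≠ 0)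
    (N : ℕ) : IsCircularGaussian (fun ω (i : Fin N) => s i ω) (block Cs N) μ[|k ⁻¹' {j}] :=
  (hmodel.soi_gaussian j hj).isCircularGaussian N

lemma interference (hmodel : GaussianMixtureModel μ k s b Cs Cb) {j : Fin K}
    (hj : μ (k ⁻¹' {j}) ≠ 0) (N : ℕ) :
    IsCircularGaussian (fun ω (i : Fin N) => b i ω) (block (Cb j) N) μ[|k ⁻¹' {j}] :=
  (hmodel.interference_gaussian j hj).isCircularGaussian N

lemma indep_batch (hmodel : GaussianMixtureModel μ k s b Cs Cb) {j : Fin K}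
    (hj : μ (k ⁻¹' {j}) ≠ 0) (N : ℕ) :
    IndepFun (fun ω (i : Fin N) => s i ω) (fun ω (i : Fin N) => b i ω) μ[|k ⁻¹' {j}] := by
  have hm : Measurable fun (x : ℕ → ℂ) (i : Fin N) => x i :=
    measurable_pi_lambda _ fun i => measurable_pi_apply _
  exact (hmodel.indep j hj).comp hm hm

lemma posSemidef_soi [IsProbabilityMeasure μ] (hmodel : GaussianMixtureModel μ k s b Cs Cb) (N : ℕ) :
    (block Cs N).PosSemidef := by
  obtain ⟨j, hj⟩ := hmodel.exists_pos
  exact (hmodel.soi hj N).posSemidef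

lemma posDef_mixtureCov [IsProbabilityMeasure μ] (hmodel : GaussianMixtureModel μ k s b Cs Cb) (j : Fin K) (N : ℕ) :
    (mixtureCov Cs (Cb j) N).PosDef := by
  obtain ⟨σ, hσ, hfloor⟩ := hmodel.noise_floor
  exact Matrix.PosDef.posSemidef_add (hmodel.posSemidef_soi N) (posDef_of_sub_smul_one hσ (hfloor j N))

lemma observation [IsProbabilityMeasure μ] (hmodel : GaussianMixtureModel μ k s b Cs Cb) {j : Fin K}
    (hj : μ (k ⁻¹' {j}) ≠ 0) (N : ℕ) :
    IsCircularGaussian (fun ω => (batch (mixture s b) N ω).ofLp) (mixtureCov Cs (Cb j) N)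
      μ[|k ⁻¹' {j}] :=
  (isCircularGaussian_error_observation (hmodel.soi hj N) (hmodel.interference hj N)
    (hmodel.indep_batch hj N) (hmodel.posDef_mixtureCov j N)).submatrix Sum.inr

/-- The variance of the observations is bounded by a constant that depends neither on the type nor
on the number of samples. -/
lemma exists_observation_variance_le (hmodel : GaussianMixtureModel μ k s b Cs Cb) :
    ∃ V : ℝ, ∀ j N i, (mixtureCov Cs (Cb j) N i i).re ≤ V := by
  obtain ⟨M, hM⟩ := hmodel.interference_variance
  refine ⟨1 + M, fun j N i => ?_⟩
  simp only [mixtureCov, block, Matrix.add_apply, Matrix.submatrix_apply, hmodel.soi_unit_variance,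
    Complex.add_re, Complex.one_re]
  linarith [hM j i]

/-- The linear MMSE estimators have norm at most `N / σ`. The bound is crude, but detection errors
are rare enough to absorb any fixed power of `N`. -/
lemma norm_lmmse_le [IsProbabilityMeasure μ] (hmodel : GaussianMixtureModel μ k s b Cs Cb) {σ : ℝ} (hσ : 0 < σ)
    (hfloor : ∀ j N, (block (Cb j) N - (σ : ℂ) • 1).PosSemidef) (j : Fin K) (N : ℕ)
    (y : EuclideanSpace ℂ (Fin N)) : ‖lmmse Cs (Cb j) N y‖ ≤ N * (‖y‖ / σ) := by
  have h1 := norm_apply_le_one (hmodel.posSemidef_soi N) fun i => hmodel.soi_unit_variance i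
  have h2 := norm_mulVec_le h1 (WithLp.toLp 2 ((block Cs N + block (Cb j) N)⁻¹ *ᵥ y.ofLp))
  rw [Matrix.mulVec_mulVec] at h2
  refine h2.trans ?_
  gcongr
  exact norm_inv_mulVec_le hσ (hmodel.posSemidef_soi N) (hfloor j N) y

lemma memLp_observation [IsProbabilityMeasure μ] (hmodel : GaussianMixtureModel μ k s b Cs Cb) (N : ℕ) :
    MemLp (batch (mixture s b) N) 2 μ :=
  memLp_two_of_cond hmodel.measurable_type
    (measurable_batch (measurable_mixture hmodel) N).aestronglyMeasurable
    fun _ hj => (hmodel.observation hj N).memLp_toLp (by simp)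

lemma memLp_soi [IsProbabilityMeasure μ] (hmodel : GaussianMixtureModel μ k s b Cs Cb) (N : ℕ) :
    MemLp (batch s N) 2 μ :=
  memLp_two_of_cond hmodel.measurable_type
    (measurable_batch hmodel.measurable_soi N).aestronglyMeasurable
    fun _ hj => (hmodel.soi hj N).memLp_toLp (by simp)

end GaussianMixtureModel

/-- The detect-then-separate estimator as a function of the observation. -/
noncomputable def dtsMap (Cs : Matrix ℕ ℕ ℂ) (Cb : Fin K → Matrix ℕ ℕ ℂ) (N : ℕ)
    (d : EuclideanSpace ℂ (Fin N) → Fin K) (y : EuclideanSpace ℂ (Fin N)) :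
    EuclideanSpace ℂ (Fin N) :=
  lmmse Cs (Cb (d y)) N y

lemma measurable_dtsMap (Cs : Matrix ℕ ℕ ℂ) (Cb : Fin K → Matrix ℕ ℕ ℂ) {N : ℕ}
    {d : EuclideanSpace ℂ (Fin N) → Fin K} (hd : Measurable d) : Measurable (dtsMap Cs Cb N d) := by
  have h : Measurable (Function.uncurry fun j : Fin K => lmmse Cs (Cb j) N) :=
    measurable_from_prod_countable_right fun j => measurable_lmmse Cs (Cb j) N
  have hdy : Measurable fun y => (d y, y) := hd.prodMk measurable_id
  have h2 := h.comp hdy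
  exact h2

lemma memLp_dtsEstimator [IsProbabilityMeasure μ] (hmodel : GaussianMixtureModel μ k s b Cs Cb) {N : ℕ}
    {d : EuclideanSpace ℂ (Fin N) → Fin K} (hd : Measurable d) :
    MemLp (dtsEstimator Cs Cb (mixture s b) N d) 2 μ := by
  obtain ⟨σ, hσ, hfloor⟩ := hmodel.noise_floor
  refine MemLp.of_le_mul (c := N / σ) (hmodel.memLp_observation N)
    ((measurable_dtsMap Cs Cb hd).comp
      (measurable_batch (measurable_mixture hmodel) N)).aestronglyMeasurable
    (ae_of_all _ fun ω => ?_)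
  refine (hmodel.norm_lmmse_le hσ hfloor _ N _).trans_eq ?_
  ring

/-! ### The mean-square error given the type -/

/-- The mean-square error of the genie-aided estimator, the linear MMSE estimator that knows the type
of the interference. It is expressed by the traces of its error covariances. -/
noncomputable def genieError (μ : Measure Ω) (k : Ω → Fin K) (Cs : Matrix ℕ ℕ ℂ)
    (Cb : Fin K → Matrix ℕ ℕ ℂ) (N : ℕ) : ℝ :=
  ∑ j, μ.real (k ⁻¹' {j}) *
    ((block Cs N * (mixtureCov Cs (Cb j) N)⁻¹ - 1) * block Cs N *
        (block Cs N * (mixtureCov Cs (Cb j) N)⁻¹ - 1)ᴴ +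
      block Cs N * (mixtureCov Cs (Cb j) N)⁻¹ * block (Cb j) N *
        (block Cs N * (mixtureCov Cs (Cb j) N)⁻¹)ᴴ).trace.re

/-- The mean-square distance of the estimator `g y` to the genie-aided estimator. -/
noncomputable def genieDistance (μ : Measure Ω) (k : Ω → Fin K) (Cs : Matrix ℕ ℕ ℂ)
    (Cb : Fin K → Matrix ℕ ℕ ℂ) (y : ℕ → Ω → ℂ) (N : ℕ)
    (g : EuclideanSpace ℂ (Fin N) → EuclideanSpace ℂ (Fin N)) : ℝ :=
  ∑ j, μ.real (k ⁻¹' {j}) *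
    ∫ ω, ‖g (batch y N ω) - lmmse Cs (Cb j) N (batch y N ω)‖ ^ 2 ∂μ[|k ⁻¹' {j}]

lemma sum_measureReal_fiber [IsProbabilityMeasure μ] (hk : Measurable k) : ∑ j, μ.real (k ⁻¹' {j}) = 1 := by
  have h := integral_eq_sum_cond (μ := μ) hk (f := fun _ => 1) (integrable_const 1)
  rw [integral_const, probReal_univ, one_smul] at h
  rw [h]
  refine Finset.sum_congr rfl fun j _ => ?_
  by_cases hj : μ (k ⁻¹' {j}) = 0
  · simp [measureReal_def, hj]
  · have := cond_isProbabilityMeasure hj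
    simp

lemma genieDistance_nonneg {y : ℕ → Ω → ℂ} {N : ℕ}
    {g : EuclideanSpace ℂ (Fin N) → EuclideanSpace ℂ (Fin N)} :
    0 ≤ genieDistance μ k Cs Cb y N g :=
  Finset.sum_nonneg fun _ _ => mul_nonneg measureReal_nonneg (integral_nonneg fun _ => by positivity)

/-- Every estimator loses to the genie-aided one exactly its mean-square distance to it. -/
lemma mse_eq_genieError_add [IsProbabilityMeasure μ] (hmodel : GaussianMixtureModel μ k s b Cs Cb) {N : ℕ}
    {g : EuclideanSpace ℂ (Fin N) → EuclideanSpace ℂ (Fin N)} (hg : Measurable g)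
    (hgL : MemLp (fun ω => g (batch (mixture s b) N ω)) 2 μ) :
    mse μ s N (fun ω => g (batch (mixture s b) N ω))
      = genieError μ k Cs Cb N + genieDistance μ k Cs Cb (mixture s b) N g := by
  have hL : MemLp (fun ω => g (batch (mixture s b) N ω) - batch s N ω) 2 μ :=
    hgL.sub (hmodel.memLp_soi N)
  rw [mse, integral_eq_sum_cond hmodel.measurable_type
    ((memLp_two_iff_integrable_sq_norm hL.1).1 hL), genieError, genieDistance,
    ← Finset.sum_add_distrib]
  refine Finset.sum_congr rfl fun j _ => ?_
  by_cases hj : μ (k ⁻¹' {j}) = 0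
  · simp [measureReal_def, hj]
  rw [← mul_add, add_comm]
  congr 1
  exact integral_norm_sub_sq_eq (hmodel.soi hj N) (hmodel.interference hj N)
    (hmodel.indep_batch hj N) (hmodel.posDef_mixtureCov j N) hg (memLp_cond hgL hj)

lemma exists_genieError_ge [IsProbabilityMeasure μ] (hmodel : GaussianMixtureModel μ k s b Cs Cb) :
    ∃ g : ℝ, 0 < g ∧ ∀ N, 0 < N → g ≤ genieError μ k Cs Cb N := by
  obtain ⟨σ, hσ, hfloor⟩ := hmodel.noise_floor
  refine ⟨min 1 σ / 4, by have := lt_min one_pos hσ; positivity, fun N hN => ?_⟩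
  have h : min 1 σ / 4 = ∑ j, μ.real (k ⁻¹' {j}) * (min 1 σ / 4) := by
    rw [← Finset.sum_mul, sum_measureReal_fiber hmodel.measurable_type, one_mul]
  rw [h]
  exact Finset.sum_le_sum fun j _ => mul_le_mul_of_nonneg_left
    (re_trace_error_ge hN hσ (hmodel.posSemidef_soi N) (fun i => hmodel.soi_unit_variance i)
      (hfloor j N) _) measureReal_nonneg

/-- The conditional expectation is a function of the observation, so it cannot beat the genie-aided
estimator. -/
lemma genieError_le_mse_mmse [IsProbabilityMeasure μ] (hmodel : GaussianMixtureModel μ k s b Cs Cb) (N : ℕ) :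
    genieError μ k Cs Cb N ≤ mse μ s N (mmseEstimator μ s (mixture s b) N) := by
  have hsm : StronglyMeasurable[sampleSigma (mixture s b) N] (mmseEstimator μ s (mixture s b) N) :=
    stronglyMeasurable_condExp
  obtain ⟨g, hg, hgy⟩ := hsm.exists_eq_measurable_comp
  have hL : MemLp (mmseEstimator μ s (mixture s b) N) 2 μ :=
    (hmodel.memLp_soi N).condExp (by norm_num)
  rw [hgy] at hL ⊢
  have := mse_eq_genieError_add hmodel hg.measurable hL
  exact this ▸ le_add_of_nonneg_right genieDistance_nonneg

lemma mse_mmse_le_mse_dts [IsProbabilityMeasure μ] (hmodel : GaussianMixtureModel μ k s b Cs Cb) {N : ℕ}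
    {d : EuclideanSpace ℂ (Fin N) → Fin K} (hd : Measurable d) :
    mse μ s N (mmseEstimator μ s (mixture s b) N)
      ≤ mse μ s N (dtsEstimator Cs Cb (mixture s b) N d) :=
  integral_norm_condExp_sub_sq_le (measurable_batch (measurable_mixture hmodel) N).comap_le
    (hmodel.memLp_soi N) (memLp_dtsEstimator hmodel hd)
    ((measurable_dtsMap Cs Cb hd).comp (comap_measurable _)).stronglyMeasurable

end Model

section Asymptotics

variable {Ω : Type*} [MeasurableSpace Ω] {μ : Measure Ω}
  {K : ℕ} {k : Ω → Fin K} {s b : ℕ → Ω → ℂ} {Cs : Matrix ℕ ℕ ℂ} {Cb : Fin K → Matrix ℕ ℕ ℂ}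

/-! ### Detection errors of the maximum a posteriori detector -/

/-- On every event that is determined by the observation and on which the detector selects `l`,
the type `l` is at least as likely as any other type. -/
lemma IsMAPDetector.measureReal_inter_le [IsProbabilityMeasure μ] (hk : Measurable k)
    {y : ℕ → Ω → ℂ} (hy : ∀ n, Measurable (y n)) {N : ℕ} {d : EuclideanSpace ℂ (Fin N) → Fin K}
    (hd : IsMAPDetector μ k y N d) (j l : Fin K) {T : Set (EuclideanSpace ℂ (Fin N))}
    (hT : MeasurableSet T) (hTl : ∀ x ∈ T, d x = l) :
    μ.real (k ⁻¹' {j} ∩ batch y N ⁻¹' T) ≤ μ.real (k ⁻¹' {l} ∩ batch y N ⁻¹' T) := by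
  have hm := (measurable_batch hy N).comap_le
  have hT' : MeasurableSet[sampleSigma y N] (batch y N ⁻¹' T) := ⟨T, hT, rfl⟩
  have hkm : ∀ i, MeasurableSet (k ⁻¹' {i}) := fun i => hk (measurableSet_singleton i)
  have key : ∀ i, ∫ ω in batch y N ⁻¹' T, (μ⟦k ⁻¹' {i} | sampleSigma y N⟧) ω ∂μ
      = μ.real (k ⁻¹' {i} ∩ batch y N ⁻¹' T) := by
    intro i
    rw [setIntegral_condExp hm ((integrable_const 1).indicator (hkm i)) hT',
      setIntegral_indicator (hkm i), setIntegral_const, smul_eq_mul, mul_one, Set.inter_comm]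
  rw [← key j, ← key l]
  refine setIntegral_mono_on_ae integrable_condExp.integrableOn integrable_condExp.integrableOn
    (hm _ hT') ?_
  filter_upwards [hd.2] with ω hω hωT
  have := hω j
  rwa [hTl _ hωT] at this

/-- The probability that a maximum a posteriori detector confuses the type `j` with `l` is at most
the sum of the two error probabilities of any test between these types. -/
lemma IsMAPDetector.measureReal_confusion_le [IsProbabilityMeasure μ] (hk : Measurable k)
    {y : ℕ → Ω → ℂ} (hy : ∀ n, Measurable (y n)) {N : ℕ} {d : EuclideanSpace ℂ (Fin N) → Fin K}
    (hd : IsMAPDetector μ k y N d) (j l : Fin K) {E : Set (EuclideanSpace ℂ (Fin N))}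
    (hE : MeasurableSet E) :
    μ.real (k ⁻¹' {j} ∩ batch y N ⁻¹' (d ⁻¹' {l}))
      ≤ (μ[|k ⁻¹' {j}]).real (batch y N ⁻¹' E) + (μ[|k ⁻¹' {l}]).real (batch y N ⁻¹' Eᶜ) := by
  have hdl : MeasurableSet (d ⁻¹' {l}) := hd.1 (measurableSet_singleton l)
  calc μ.real (k ⁻¹' {j} ∩ batch y N ⁻¹' (d ⁻¹' {l}))
      ≤ μ.real ((k ⁻¹' {j} ∩ batch y N ⁻¹' E) ∪ (k ⁻¹' {j} ∩ batch y N ⁻¹' (d ⁻¹' {l} ∩ Eᶜ))) := by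
        refine measureReal_mono ?_
        rintro ω ⟨h1, h2⟩
        by_cases h : batch y N ω ∈ E
        · exact Or.inl ⟨h1, h⟩
        · exact Or.inr ⟨h1, h2, h⟩
    _ ≤ μ.real (k ⁻¹' {j} ∩ batch y N ⁻¹' E) + μ.real (k ⁻¹' {j} ∩ batch y N ⁻¹' (d ⁻¹' {l} ∩ Eᶜ)) :=
        measureReal_union_le _ _
    _ ≤ (μ[|k ⁻¹' {j}]).real (batch y N ⁻¹' E) + μ.real (k ⁻¹' {l} ∩ batch y N ⁻¹' (d ⁻¹' {l} ∩ Eᶜ)) :=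
        add_le_add (measureReal_inter_le_cond (hk (measurableSet_singleton j)) _)
          (hd.measureReal_inter_le hk hy j l (hdl.inter hE.compl) fun _ hx => hx.1)
    _ ≤ (μ[|k ⁻¹' {j}]).real (batch y N ⁻¹' E) + μ.real (k ⁻¹' {l} ∩ batch y N ⁻¹' Eᶜ) := by
        exact add_le_add le_rfl (measureReal_mono
          (Set.inter_subset_inter_right _ (Set.preimage_mono Set.inter_subset_right)))
    _ ≤ _ := by
        gcongr
        exact measureReal_inter_le_cond (hk (measurableSet_singleton l)) _

lemma measurable_psi (Cs Cj : Matrix ℕ ℕ ℂ) (N : ℕ) : Measurable (psi Cs Cj N) := by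
  have h : Continuous fun y : Fin N → ℂ => (mixtureCov Cs Cj N)⁻¹ *ᵥ y :=
    LinearMap.continuous_of_finiteDimensional (Matrix.mulVecLin (mixtureCov Cs Cj N)⁻¹)
  have h2 : Continuous fun y : Fin N → ℂ => (star y ⬝ᵥ ((mixtureCov Cs Cj N)⁻¹ *ᵥ y)).re :=
    Complex.continuous_re.comp (continuous_star.dotProduct h)
  exact ((h2.measurable.comp (WithLp.measurable_ofLp 2 _)).const_mul _).sub_const 1

/-- Given the type `j`, the normalized quadratic form of a different type is close to `1` with
vanishing probability. -/
lemma GaussianMixtureModel.tendsto_measureReal_abs_psi_lt [IsProbabilityMeasure μ]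
    (hmodel : GaussianMixtureModel μ k s b Cs Cb) {j l : Fin K} {c : ℝ}
    (h : ∀ᵐ ω ∂μ[|k ⁻¹' {j}], ∀ᶠ N in atTop, c ≤ |psi Cs (Cb l) N (batch (mixture s b) N ω)|) :
    Tendsto (fun N => (μ[|k ⁻¹' {j}]).real {ω | |psi Cs (Cb l) N (batch (mixture s b) N ω)| < c})
      atTop (𝓝 0) := by
  have hlim := tendsto_measure_of_ae_tendsto_indicator_of_isFiniteMeasure (μ := μ[|k ⁻¹' {j}]) atTop
    (A := ∅) (As := fun N => {ω | |psi Cs (Cb l) N (batch (mixture s b) N ω)| < c})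
    MeasurableSet.empty (fun N => by
      have := ((measurable_psi Cs (Cb l) N).comp (measurable_batch (measurable_mixture hmodel) N)).abs
      exact measurableSet_lt this measurable_const) (by
      filter_upwards [h] with ω hω
      filter_upwards [hω] with N hN
      simpa using hN)
  rw [measure_empty] at hlim
  exact (ENNReal.tendsto_toReal ENNReal.zero_ne_top).comp hlim

/-- Two types are told apart by a test whose error probabilities are at most `N⁻⁸`. Simultaneous
diagonalization of the two covariance matrices and passing to real and imaginary parts reduce this
to a test between product Gaussian laws in dimension `2 * N`; the quadratic form that enters
`exists_test` is `psi + 1`. -/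
lemma GaussianMixtureModel.eventually_exists_test [IsProbabilityMeasure μ]
    (hmodel : GaussianMixtureModel μ k s b Cs Cb)
    {j l : Fin K} (hj : μ (k ⁻¹' {j}) ≠ 0) (hl : μ (k ⁻¹' {l}) ≠ 0) {c : ℝ} (hc : 0 < c)
    (h : ∀ᵐ ω ∂μ[|k ⁻¹' {j}], ∀ᶠ N in atTop, c ≤ |psi Cs (Cb l) N (batch (mixture s b) N ω)|) :
    ∀ᶠ N : ℕ in atTop, ∃ E : Set (EuclideanSpace ℂ (Fin N)), MeasurableSet E ∧
      (μ[|k ⁻¹' {j}]).real (batch (mixture s b) N ⁻¹' E) ≤ ((N : ℝ) ^ 8)⁻¹ ∧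
      (μ[|k ⁻¹' {l}]).real (batch (mixture s b) N ⁻¹' Eᶜ) ≤ ((N : ℝ) ^ 8)⁻¹ := by
  obtain ⟨σ, hσ, hfloor⟩ := hmodel.noise_floor
  obtain ⟨V, hV⟩ := hmodel.exists_observation_variance_le
  obtain ⟨ε, hε, htest⟩ := exists_test 8 hc (le_max_left 1 (V / σ))
  have hdouble : Tendsto (fun N : ℕ => 2 * N) atTop atTop :=
    tendsto_id.const_mul_atTop' two_pos
  filter_upwards [hdouble.eventually htest, eventually_gt_atTop 0,
    (hmodel.tendsto_measureReal_abs_psi_lt h).eventually_le_const hε] with N htest hN hsmall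
  have hN' : (0 : ℝ) < N := by exact_mod_cast hN
  have hbm := measurable_batch (measurable_mixture hmodel) N
  have hPj := cond_isProbabilityMeasure (μ := μ) hj
  obtain ⟨W, a, ha, hWA, hWB, hBinv⟩ := exists_simultaneous_diagonalization
    (hmodel.posDef_mixtureCov j N) (hmodel.posDef_mixtureCov l N)
  have hZj := (hmodel.observation hj N).mulVec W
  have hZl := (hmodel.observation hl N).mulVec W
  rw [hWA] at hZj
  rw [hWB] at hZl
  have hquad : ∀ y : EuclideanSpace ℂ (Fin N),
      (star y.ofLp ⬝ᵥ ((mixtureCov Cs (Cb l) N)⁻¹ *ᵥ y.ofLp)).re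
        = ∑ i, a i * ‖(W *ᵥ y.ofLp) i‖ ^ 2 := fun y => by
    rw [hBinv, dotProduct_diagonal_mulVec]
  -- `∑ i, a i` is the mean of the quadratic form of type `l` given type `j`
  have hsum : ∑ i, a i ≤ V / σ * N := by
    have hY := hmodel.observation hj N
    calc ∑ i, a i = ∑ i, a i * ∫ ω, ‖(W *ᵥ (batch (mixture s b) N ω).ofLp) i‖ ^ 2 ∂μ[|k ⁻¹' {j}] := by
          refine Finset.sum_congr rfl fun i _ => ?_
          rw [hZj.integral_norm_sq_eq_re i, Matrix.one_apply_eq, Complex.one_re, mul_one]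
      _ = ∫ ω, ∑ i, a i * ‖(W *ᵥ (batch (mixture s b) N ω).ofLp) i‖ ^ 2 ∂μ[|k ⁻¹' {j}] := by
          rw [integral_finsetSum _ fun i _ => (hZj.integrable_norm_sq i).const_mul _]
          exact Finset.sum_congr rfl fun i _ => (integral_const_mul _ _).symm
      _ ≤ ∫ ω, ‖batch (mixture s b) N ω‖ ^ 2 / σ ∂μ[|k ⁻¹' {j}] := by
          refine integral_mono (integrable_finsetSum _ fun i _ =>
            (hZj.integrable_norm_sq i).const_mul _) ?_ fun ω => ?_
          · exact (hY.memLp_toLp (p := 2) (by simp)).integrable_norm_pow (by simp) |>.div_const _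
          · dsimp only
            rw [← hquad]
            exact re_dotProduct_inv_mulVec_le hσ (hmodel.posSemidef_soi N) (hfloor l N) _
      _ = (mixtureCov Cs (Cb j) N).trace.re / σ := by
          rw [integral_div]
          congr 1
          exact hY.integral_toLp_norm_sq
      _ ≤ (∑ _i : Fin N, V) / σ := by
          rw [Matrix.trace, Complex.re_sum]
          gcongr with i
          exact hV j N i
      _ = V / σ * N := by simp; ring
  have hmapj := IsCircularGaussian.map_reIm_eq_stdNormal (v := fun _ : Fin N => 1) (fun _ => one_pos)
    (by simpa using hZj)
  have hmapl := IsCircularGaussian.map_reIm_eq_stdNormal (fun i => inv_pos.2 (ha i)) hZl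
  set Φ : EuclideanSpace ℂ (Fin N) → Fin N × Bool → ℝ :=
    fun y p => √2 * reIm (W *ᵥ y.ofLp) p with hΦ
  have hreIm : Measurable fun y : Fin N → ℂ => reIm (W *ᵥ y) :=
    (LinearMap.continuous_of_finiteDimensional
      (reIm ∘ₗ (Matrix.mulVecLin W).restrictScalars ℝ)).measurable
  have hrb : Measurable fun ω => reIm (W *ᵥ (batch (mixture s b) N ω).ofLp) :=
    hreIm.comp ((WithLp.measurable_ofLp 2 _).comp hbm)
  have hΦm : Measurable Φ := measurable_pi_lambda _ fun p =>
    ((measurable_pi_apply p).comp (hreIm.comp (WithLp.measurable_ofLp 2 _))).const_mul _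
  have hΦb : Measurable fun ω => Φ (batch (mixture s b) N ω) := hΦm.comp hbm
  have hmapj' : (μ[|k ⁻¹' {j}]).map (fun ω => Φ (batch (mixture s b) N ω))
      = stdNormal (Fin N × Bool) := by
    rw [← hmapj]
    simp only [div_one, hΦ]
  obtain ⟨G, hG, hGj, hGl⟩ := htest (Fin N × Bool) (by simp [mul_comm]) (fun p => a p.1)
    (fun p => ha p.1) (by
      rw [Fintype.sum_prod_type]
      simp only [Finset.sum_const, Finset.card_univ, Fintype.card_bool, nsmul_eq_mul]
      rw [← Finset.mul_sum]
      push_cast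
      have := mul_le_mul_of_nonneg_right (le_max_right 1 (V / σ)) hN'.le
      linarith) (by
      rw [← hmapj', map_measureReal_apply hΦb (by
        refine measurableSet_lt ?_ measurable_const
        exact ((((Finset.measurable_sum _ fun p _ =>
          ((measurable_pi_apply p).pow_const 2).const_mul _)).div_const _).sub_const 1).abs)]
      refine (measureReal_mono fun ω hω => ?_).trans hsmall
      have hpsi : psi Cs (Cb l) N (batch (mixture s b) N ω)
          = (∑ p, a p.1 * Φ (batch (mixture s b) N ω) p ^ 2) / ((2 * N : ℕ) : ℝ) - 1 := by
        rw [psi, hquad, ← sum_reIm_sq]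
        simp only [hΦ, mul_pow, Real.sq_sqrt zero_le_two]
        push_cast
        simp only [mul_left_comm _ (2 : ℝ), ← Finset.mul_sum]
        field_simp
      simpa only [Set.mem_ofPred_eq, Set.mem_preimage, hpsi] using hω)
  have hpow : ((((2 * N : ℕ) : ℝ)) ^ 8)⁻¹ ≤ ((N : ℝ) ^ 8)⁻¹ := by
    push_cast
    gcongr
    linarith
  refine ⟨Φ ⁻¹' G, hΦm hG, ?_, ?_⟩
  · rw [← hmapj', map_measureReal_apply hΦb hG] at hGj
    exact hGj.trans hpow
  · have hrescale : Measurable fun (x : Fin N × Bool → ℝ) p => x p / √(a p.1) :=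
      measurable_pi_lambda _ fun p => (measurable_pi_apply p).div_const _
    have hZm : Measurable fun ω (p : Fin N × Bool) =>
        √(2 / (a p.1)⁻¹) * reIm (W *ᵥ (batch (mixture s b) N ω).ofLp) p :=
      measurable_pi_lambda _ fun p => ((measurable_pi_apply p).comp hrb).const_mul _
    have hGm : MeasurableSet {x : Fin N × Bool → ℝ | (fun p => x p / √(a p.1)) ∉ G} :=
      hrescale hG.compl
    rw [← hmapl, map_measureReal_apply hZm hGm] at hGl
    refine le_trans (le_of_eq ?_) (hGl.trans hpow)
    congr 1
    ext ω
    simp only [Set.mem_preimage, Set.mem_compl_iff, Set.mem_ofPred_eq]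
    have : Φ (batch (mixture s b) N ω) = fun p : Fin N × Bool =>
        √(2 / (a p.1)⁻¹) * reIm (W *ᵥ (batch (mixture s b) N ω).ofLp) p / √(a p.1) := by
      ext p
      have := Real.sqrt_pos.2 (ha p.1)
      rw [div_inv_eq_mul, Real.sqrt_mul zero_le_two]
      simp only [hΦ]
      field_simp
    rw [this]

/-- A maximum a posteriori detector confuses two given types with a probability of order `N⁻⁸`. -/
lemma GaussianMixtureModel.eventually_confusion_le [IsProbabilityMeasure μ]
    (hmodel : GaussianMixtureModel μ k s b Cs Cb) (hTDC : TemporalDiversity μ k s b Cs Cb)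
    {d : (N : ℕ) → EuclideanSpace ℂ (Fin N) → Fin K}
    (hd : ∀ N, IsMAPDetector μ k (mixture s b) N (d N)) {j l : Fin K} (hlj : l ≠ j) :
    ∀ᶠ N : ℕ in atTop, μ.real (k ⁻¹' {j} ∩ batch (mixture s b) N ⁻¹' (d N ⁻¹' {l}))
      ≤ 2 * ((N : ℝ) ^ 8)⁻¹ := by
  by_cases hj : μ (k ⁻¹' {j}) = 0
  · refine Eventually.of_forall fun N => ?_
    rw [measureReal_def, measure_inter_null_of_null_left _ hj, ENNReal.toReal_zero]
    positivity
  by_cases hl : μ (k ⁻¹' {l}) = 0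
  -- a type of probability zero is almost surely never selected by the detector
  · refine Eventually.of_forall fun N => ?_
    refine ((hd N).measureReal_inter_le hmodel.measurable_type (measurable_mixture hmodel) j l
      ((hd N).1 (measurableSet_singleton l)) fun _ hx => hx).trans ?_
    rw [measureReal_def, measure_inter_null_of_null_left _ hl, ENNReal.toReal_zero]
    positivity
  obtain ⟨c, hc, h⟩ := hTDC j l hlj
  filter_upwards [hmodel.eventually_exists_test hj hl hc h] with N ⟨E, hE, h1, h2⟩
  have := (hd N).measureReal_confusion_le hmodel.measurable_type (measurable_mixture hmodel) j l hE
  linarith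

/-! ### Asymptotic optimality -/

/-- Polynomially small detection error probabilities make the detect-then-separate estimator
asymptotically equal to the genie-aided one in mean square. The term `N ^ 7` balances the growth of
the estimators against the detection errors. -/
lemma GaussianMixtureModel.exists_genieDistance_dtsMap_le [IsProbabilityMeasure μ]
    (hmodel : GaussianMixtureModel μ k s b Cs Cb) :
    ∃ A : ℝ, ∀ (N : ℕ) (d : EuclideanSpace ℂ (Fin N) → Fin K), 0 < N → Measurable d →
      genieDistance μ k Cs Cb (mixture s b) N (dtsMap Cs Cb N d)
        ≤ A * (N ^ 7 * (∑ j, ∑ l with l ≠ j,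
            μ.real (k ⁻¹' {j} ∩ batch (mixture s b) N ⁻¹' (d ⁻¹' {l}))) + (N : ℝ)⁻¹) := by
  obtain ⟨σ, hσ, hfloor⟩ := hmodel.noise_floor
  obtain ⟨V, hV⟩ := hmodel.exists_observation_variance_le
  set κ : ℝ := (∫ x, x ^ 4 ∂gaussianReal 0 1) * V ^ 2 with hκ
  have hκ0 : 0 ≤ κ := mul_nonneg (integral_nonneg fun x => by positivity) (sq_nonneg V)
  -- `κ` bounds the fourth moment of the norm of the observation divided by `N ^ 2`
  refine ⟨4 / σ ^ 2 * max 1 κ, fun N d hN hd => ?_⟩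
  have hN' : (0 : ℝ) < N := by exact_mod_cast hN
  have hbm := measurable_batch (measurable_mixture hmodel) N
  have hkm : ∀ j, MeasurableSet (k ⁻¹' {j}) := fun j =>
    hmodel.measurable_type (measurableSet_singleton j)
  have hterm : ∀ j, μ.real (k ⁻¹' {j}) * ∫ ω, ‖dtsMap Cs Cb N d (batch (mixture s b) N ω)
        - lmmse Cs (Cb j) N (batch (mixture s b) N ω)‖ ^ 2 ∂μ[|k ⁻¹' {j}]
      ≤ 4 / σ ^ 2 * (N ^ 7 * (∑ l with l ≠ j,
          μ.real (k ⁻¹' {j} ∩ batch (mixture s b) N ⁻¹' (d ⁻¹' {l})))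
        + μ.real (k ⁻¹' {j}) * (κ * (N : ℝ)⁻¹)) := by
    intro j
    by_cases hj : μ (k ⁻¹' {j}) = 0
    · have h0 : μ.real (k ⁻¹' {j}) = 0 := by rw [measureReal_def, hj, ENNReal.toReal_zero]
      rw [h0, zero_mul, zero_mul, add_zero]
      positivity
    have hPj := cond_isProbabilityMeasure (μ := μ) hj
    have hY := hmodel.observation hj N
    set S : Set Ω := batch (mixture s b) N ⁻¹' (d ⁻¹' {j})ᶜ with hS
    have hSm : MeasurableSet S := hbm (hd (measurableSet_singleton j)).compl
    have hpt : ∀ ω, ‖dtsMap Cs Cb N d (batch (mixture s b) N ω)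
          - lmmse Cs (Cb j) N (batch (mixture s b) N ω)‖ ^ 2
        ≤ 4 / σ ^ 2 * (N ^ 7 * S.indicator (fun _ => 1) ω
          + ‖batch (mixture s b) N ω‖ ^ 4 / N ^ 3) := by
      intro ω
      set y := batch (mixture s b) N ω with hy
      by_cases hdy : d y = j
      · rw [dtsMap, hdy, sub_self, norm_zero, zero_pow two_ne_zero]
        have : 0 ≤ S.indicator (fun _ => (1 : ℝ)) ω := Set.indicator_nonneg (fun _ _ => zero_le_one) _
        positivity
      · have hω : ω ∈ S := hdy
        rw [Set.indicator_of_mem hω, mul_one]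
        have h1 := (norm_sub_le _ _).trans (add_le_add (hmodel.norm_lmmse_le hσ hfloor (d y) N y)
          (hmodel.norm_lmmse_le hσ hfloor j N y))
        have h2 : ‖dtsMap Cs Cb N d y - lmmse Cs (Cb j) N y‖ ^ 2 ≤ (2 * (N * (‖y‖ / σ))) ^ 2 :=
          pow_le_pow_left₀ (norm_nonneg _) (h1.trans_eq (two_mul _).symm) 2
        refine h2.trans ?_
        have h3 : (2 * (N * (‖y‖ / σ))) ^ 2 = 4 / σ ^ 2 * (N ^ 2 * ‖y‖ ^ 2) := by field_simp; ring
        rw [h3]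
        gcongr
        rw [← sub_nonneg]
        -- the inequality between the arithmetic and geometric means of the two terms
        have h4 : (N : ℝ) ^ 7 + ‖y‖ ^ 4 / N ^ 3 - N ^ 2 * ‖y‖ ^ 2
            = ((N ^ 5 - ‖y‖ ^ 2) ^ 2 + N ^ 5 * ‖y‖ ^ 2) / N ^ 3 := by field_simp; ring
        rw [h4]
        positivity
    have hi4 : Integrable (fun ω => ‖batch (mixture s b) N ω‖ ^ 4) μ[|k ⁻¹' {j}] :=
      (hY.memLp_toLp (p := 4) (by simp)).integrable_norm_pow (by simp)
    have hi1 : Integrable (S.indicator fun _ => (1 : ℝ)) μ[|k ⁻¹' {j}] :=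
      (integrable_const 1).indicator hSm
    have hmain := integral_mono_of_nonneg (ae_of_all _ fun ω => by positivity)
      (((hi1.const_mul (N ^ 7 : ℝ)).add (hi4.div_const (N ^ 3 : ℝ))).const_mul (4 / σ ^ 2))
      (ae_of_all μ[|k ⁻¹' {j}] hpt)
    have hval : ∫ ω, 4 / σ ^ 2 * (N ^ 7 * S.indicator (fun _ => 1) ω
          + ‖batch (mixture s b) N ω‖ ^ 4 / N ^ 3) ∂μ[|k ⁻¹' {j}]
        ≤ 4 / σ ^ 2 * (N ^ 7 * (μ[|k ⁻¹' {j}]).real S + κ * (N : ℝ)⁻¹) := by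
      rw [integral_const_mul, integral_add (hi1.const_mul _) (hi4.div_const _), integral_const_mul,
        integral_indicator_const _ hSm, smul_eq_mul, mul_one, integral_div]
      gcongr
      rw [div_le_iff₀ (by positivity)]
      have h4 := hY.integral_toLp_norm_pow_four_le (hV j N)
      rw [Fintype.card_fin] at h4
      refine h4.trans_eq ?_
      rw [← hκ]
      field_simp
    have hSj : μ.real (k ⁻¹' {j}) * (μ[|k ⁻¹' {j}]).real S
        = ∑ l with l ≠ j, μ.real (k ⁻¹' {j} ∩ batch (mixture s b) N ⁻¹' (d ⁻¹' {l})) := by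
      have h5 : μ.real (k ⁻¹' {j}) * (μ[|k ⁻¹' {j}]).real S = μ.real (k ⁻¹' {j} ∩ S) := by
        rw [measureReal_def, measureReal_def, measureReal_def, ← cond_mul_eq_inter (hkm j),
          ENNReal.toReal_mul, mul_comm]
      have h6 : k ⁻¹' {j} ∩ S = ⋃ l ∈ Finset.univ.filter (fun l => l ≠ j),
          k ⁻¹' {j} ∩ batch (mixture s b) N ⁻¹' (d ⁻¹' {l}) := by
        ext ω
        simp [hS]
      rw [h5, h6, measureReal_biUnion_finset]
      · intro l _ l' _ hll'
        refine Set.disjoint_left.2 fun ω h1 h2 => hll' ?_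
        exact h1.2.symm.trans h2.2
      · exact fun l _ => (hkm j).inter (hbm (hd (measurableSet_singleton l)))
    calc _ ≤ μ.real (k ⁻¹' {j}) * (4 / σ ^ 2 * (N ^ 7 * (μ[|k ⁻¹' {j}]).real S + κ * (N : ℝ)⁻¹)) :=
          mul_le_mul_of_nonneg_left (hmain.trans hval) measureReal_nonneg
      _ = _ := by rw [← hSj]; ring
  refine (Finset.sum_le_sum fun j _ => hterm j).trans ?_
  rw [← Finset.mul_sum, Finset.sum_add_distrib, ← Finset.mul_sum, ← Finset.sum_mul,
    sum_measureReal_fiber hmodel.measurable_type, one_mul,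
    mul_assoc (4 / σ ^ 2)]
  refine mul_le_mul_of_nonneg_left ?_ (by positivity)
  rw [mul_add]
  refine add_le_add (le_mul_of_one_le_left ?_ (le_max_left _ _))
    (mul_le_mul_of_nonneg_right (le_max_right _ _) (by positivity))
  positivity

lemma GaussianMixtureModel.tendsto_genieDistance_dtsMap [IsProbabilityMeasure μ]
    (hmodel : GaussianMixtureModel μ k s b Cs Cb) (hTDC : TemporalDiversity μ k s b Cs Cb)
    {d : (N : ℕ) → EuclideanSpace ℂ (Fin N) → Fin K}
    (hd : ∀ N, IsMAPDetector μ k (mixture s b) N (d N)) :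
    Tendsto (fun N => genieDistance μ k Cs Cb (mixture s b) N (dtsMap Cs Cb N (d N)))
      atTop (𝓝 0) := by
  obtain ⟨A, hA⟩ := hmodel.exists_genieDistance_dtsMap_le
  have hconf : Tendsto (fun N : ℕ => (N : ℝ) ^ 7 * ∑ j, ∑ l with l ≠ j,
      μ.real (k ⁻¹' {j} ∩ batch (mixture s b) N ⁻¹' (d N ⁻¹' {l}))) atTop (𝓝 0) := by
    simp_rw [Finset.mul_sum]
    have h0 : (0 : ℝ) = ∑ j : Fin K, ∑ l : Fin K with l ≠ j, (0 : ℝ) := by simp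
    rw [h0]
    refine tendsto_finsetSum _ fun j _ => tendsto_finsetSum _ fun l hl => ?_
    have hinv : Tendsto (fun N : ℕ => 2 * (N : ℝ)⁻¹) atTop (𝓝 0) := by
      simpa using (tendsto_inv_atTop_nhds_zero_nat (𝕜 := ℝ)).const_mul 2
    refine squeeze_zero' (Eventually.of_forall fun N => by positivity) ?_ hinv
    filter_upwards [hmodel.eventually_confusion_le hTDC hd (Finset.mem_filter.1 hl).2,
      eventually_gt_atTop 0] with N h hN
    have hN' : (0 : ℝ) < N := by exact_mod_cast hN
    refine (mul_le_mul_of_nonneg_left h (by positivity)).trans_eq ?_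
    field_simp
  have hbound := (hconf.add (tendsto_inv_atTop_nhds_zero_nat (𝕜 := ℝ))).const_mul A
  rw [add_zero, mul_zero] at hbound
  refine squeeze_zero' (Eventually.of_forall fun N => genieDistance_nonneg) ?_ hbound
  filter_upwards [eventually_gt_atTop 0] with N hN
  exact hA N (d N) hN (hd N).1

lemma mse_dts_eq [IsProbabilityMeasure μ] (hmodel : GaussianMixtureModel μ k s b Cs Cb) {N : ℕ}
    {d : EuclideanSpace ℂ (Fin N) → Fin K} (hd : Measurable d) :
    mse μ s N (dtsEstimator Cs Cb (mixture s b) N d) = genieError μ k Cs Cb N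
      + genieDistance μ k Cs Cb (mixture s b) N (dtsMap Cs Cb N d) := by
  have h := mse_eq_genieError_add hmodel (measurable_dtsMap Cs Cb hd) (memLp_dtsEstimator hmodel hd)
  exact h

end Asymptotics

end DTS

theorem theorem1 {Ω : Type*} [MeasurableSpace Ω] (μ : Measure Ω) [IsProbabilityMeasure μ]
    {K : ℕ} (k : Ω → Fin K) (s b : ℕ → Ω → ℂ)
    (Cs : Matrix ℕ ℕ ℂ) (Cb : Fin K → Matrix ℕ ℕ ℂ)
    (hmodel : DTS.GaussianMixtureModel μ k s b Cs Cb)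
    (hTDC : DTS.TemporalDiversity μ k s b Cs Cb)
    (kMAP : (N : ℕ) → EuclideanSpace ℂ (Fin N) → Fin K)
    (hMAP : ∀ N, DTS.IsMAPDetector μ k (DTS.mixture s b) N (kMAP N)) :
    Tendsto
      (fun N : ℕ =>
        DTS.mse μ s N (DTS.mmseEstimator μ s (DTS.mixture s b) N) /
          DTS.mse μ s N (DTS.dtsEstimator Cs Cb (DTS.mixture s b) N (kMAP N)))
      atTop (𝓝 1) := by
  obtain ⟨g, hg, hgenie⟩ := DTS.exists_genieError_ge hmodel
  have hlower := ((hmodel.tendsto_genieDistance_dtsMap hTDC hMAP).div_const g).const_sub 1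
  rw [zero_div, sub_zero] at hlower
  refine tendsto_of_tendsto_of_tendsto_of_le_of_le' hlower tendsto_const_nhds ?_ ?_
  · filter_upwards [eventually_gt_atTop 0] with N hN
    have hG := hgenie N hN
    have hD : 0 ≤ DTS.genieDistance μ k Cs Cb (DTS.mixture s b) N (DTS.dtsMap Cs Cb N (kMAP N)) :=
      DTS.genieDistance_nonneg
    have hmm := DTS.genieError_le_mse_mmse hmodel N
    rw [DTS.mse_dts_eq hmodel (hMAP N).1, le_div_iff₀ (by linarith)]
    refine le_trans ?_ hmm
    set G := DTS.genieError μ k Cs Cb N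
    set D := DTS.genieDistance μ k Cs Cb (DTS.mixture s b) N (DTS.dtsMap Cs Cb N (kMAP N))
    have h1 : D / g * g = D := div_mul_cancel₀ D hg.ne'
    have h2 : 0 ≤ D / g := by positivity
    nlinarith
  · filter_upwards with N
    exact div_le_one_of_le₀ (DTS.mse_mmse_le_mse_dts hmodel (hMAP N).1)
      (integral_nonneg fun ω => by positivity)
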